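/- **Setting.** Let $\mathcal X$ be an input space (for instance a compact subset of $\mathbb R^d$) and let $\mathcal X_1\supseteq\mathcal X_2\supseteq\dots\supseteq\mathcal X_s$ be finite, hierarchically nested designs in $\mathcal X$, with $n_t=|\mathcal X_t|$. For each level $t$ let $\mathbf h_t:\mathcal X\to\mathbb R^{p_t}$ be a vector of fixed basis functions and $r(\cdot,\cdot\mid\boldsymbol\phi_t)$ a correlation function, with correlation parameters $\boldsymbol\phi_t$ that are held fixed. Given parameters $\boldsymbol\beta_t\in\mathbb R^{p_t}$, $\gamma_{t-1}\in\mathbb R$ ($t\ge2$), $\sigma_t^2>0$, the autoregressive cokriging model is $$y_1(\cdot)=\delta_1(\cdot),\qquad y_t(\cdot)=\gamma_{t-1}\,y_{t-1}(\cdot)+\delta_t(\cdot)\quad(t=2,\dots,s),$$ where $\delta_1,\dots,\delta_s$ are independent Gaussian processes, $\delta_t\sim\mathcal{GP}(\mathbf h_t(\cdot)^\top\boldsymbol\beta_t,\ \sigma_t^2\,r(\cdot,\cdot\mid\boldsymbol\phi_t))$. Let $\mathbf y_t=(y_t(\mathbf x))_{\mathbf x\in\mathcal X_t}$ and $\mathbf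 y=(\mathbf y_1,\dots,\mathbf y_s)$ be the data. Place on the parameters the (improper) reference prior with density proportional to $\prod_{t=1}^s\sigma_t^{-2}$ with respect to Lebesgue measure in $(\boldsymbol\beta_t,\gamma_{t-1},\sigma_t^2)_{t}$ (with no $\gamma$ at level $1$). **Notation.** Put $\mathbf H_t=\mathbf h_t(\mathcal X_t)$ (an $n_t\times p_t$ matrix), $\mathbf R_t=r(\mathcal X_t,\mathcal X_t\mid\boldsymbol\phi_t)$, $\mathbf r_t(\mathbf x_0)=r(\mathcal X_t,\mathbf x_0\mid\boldsymbol\phi_t)$; $\mathbf X_1=\mathbf H_1$ and $\mathbf X_t=[\mathbf H_t,\ y_{t-1}(\mathcal X_t)]$ for $t>1$; $\mathbf X_1(\mathbf x_0)=\mathbf h_1(\mathbf x_0)$ and $\mathbf X_t(\mathbf x_0)=[\mathbf h_t(\mathbf x_0)^\top,\ y_{t-1}(\mathbf x_0)]^\top$ for $t>1$; let $q_t$ be the number of columns of $\mathbf X_t$. Put $$\hat{\mathbf b}_t=(\hat{\boldsymbol\beta}_t^\top,\hat\gamma_{t-1})^\top=(\mathbf X_t^\top\mathbf R_t^{-1}\mathbf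 X_t)^{-1}\mathbf X_t^\top\mathbf R_t^{-1}\mathbf y_t,$$ $$\mu_t(\mathbf x_0)=\mathbf X_t(\mathbf x_0)^\top\hat{\mathbf b}_t+\mathbf r_t(\mathbf x_0)^\top\mathbf R_t^{-1}(\mathbf y_t-\mathbf X_t\hat{\mathbf b}_t),\qquad \hat\sigma_t^2=\frac{(\mathbf y_t-\mathbf X_t\hat{\mathbf b}_t)^\top\mathbf R_t^{-1}(\mathbf y_t-\mathbf X_t\hat{\mathbf b}_t)}{n_t-q_t},$$ $$c_t^*=r(\mathbf x_0,\mathbf x_0\mid\boldsymbol\phi_t)-\mathbf r_t(\mathbf x_0)^\top\mathbf R_t^{-1}\mathbf r_t(\mathbf x_0)+\mathbf a_t^\top(\mathbf X_t^\top\mathbf R_t^{-1}\mathbf X_t)^{-1}\mathbf a_t,\qquad \mathbf a_t=\mathbf X_t(\mathbf x_0)-\mathbf X_t^\top\mathbf R_t^{-1}\mathbf r_t(\mathbf x_0).$$ Here $t_\nu(\mu,\Sigma)$ denotes the law of $\mu+\sqrt{\Sigma}\,T$, where $T$ has the standard Student $t$-distribution with $\nu$ degrees of freedom (the point mass at $\mu$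 if $\Sigma=0$). **Lemma.** Assume that every $\mathbf R_t$ is positive definite, every $\mathbf H_t$ has full column rank, and $n_t>q_t$ for all $t$. Let $\mathbf x_0\in\mathcal X$ be any input and $\mathbf y(\mathbf x_0)=(y_1(\mathbf x_0),\dots,y_s(\mathbf x_0))$. Let $J$ be the (infinite) joint law of $(\mathbf y,\mathbf y(\mathbf x_0))$ obtained by integrating the parameters out against the prior. 1. The marginal of $\mathbf y$ under $J$ is $\sigma$-finite and mutually absolutely continuous with Lebesgue measure, so that predictive laws given $\mathbf y$ are well defined for almost every $\mathbf y$; and for almost every $\mathbf y$, for every $t$, $\mathbf X_t^\top\mathbf R_t^{-1}\mathbf X_t$ is invertible and $\hat\sigma_t^2>0$. 2. The joint predictive law (the conditional law of $\mathbf y(\mathbf x_0)$ given $\mathbf y$ and $\boldsymbol\phi$) factors level by level: $$\pi(\mathbf y(\mathbf x_0)\mid\mathbf y,\boldsymbol\phi)=\pi(y_1(\mathbf x_0)\mid\mathbf y_1,\boldsymbol\phi_1)\prod_{t=2}^{s}\pi(y_t(\mathbf x_0)\mid\mathbf y_{t-1},y_{t-1}(\mathbf x_0),\mathbf y_t,\boldsymbol\phi_t),$$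 an identity of probability laws on $\mathbb R^s$, in which the factor at level $t$ is the Student distribution $t_{n_t-q_t}\big(\mu_t(\mathbf x_0),\ \hat\sigma_t^2c_t^*\big)$. 3. For each $t$, this Student distribution is the conditional law under $J$ of $y_t(\mathbf x_0)$ given $\mathbf y$ and $y_1(\mathbf x_0),\dots,y_{t-1}(\mathbf x_0)$ (the joint law of these conditioning variables being $\sigma$-finite); it depends on them only through $\mathbf y_{t-1}$, $\mathbf y_t$ and $y_{t-1}(\mathbf x_0)$. 4. $\hat{\mathbf b}_t$ is the generalized least squares estimate: whenever $\mathbf X_t^\top\mathbf R_t^{-1}\mathbf X_t$ is invertible, it is the unique minimizer of $\mathbf b\mapsto(\mathbf y_t-\mathbf X_t\mathbf b)^\top\mathbf R_t^{-1}(\mathbf y_t-\mathbf X_t\mathbf b)$. -/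

import Mathlib

open MeasureTheory ProbabilityTheory
open scoped ENNReal Matrix

/-- The density of the standard Student `t`-distribution with `ν` degrees of freedom. -/
noncomputable def studentTPDF (ν x : ℝ) : ℝ :=
  Real.Gamma ((ν + 1) / 2) / (Real.sqrt (ν * Real.pi) * Real.Gamma (ν / 2)) *
    (1 + x ^ 2 / ν) ^ (-((ν + 1) / 2))

/-- The location-scale Student distribution `t_ν(μ, Σ)`, where `Σ` is the squared scale: the law of
`μ + √Σ T`, with `T` standard Student. For `Σ = 0` it is the point mass at `μ`. -/
noncomputable def studentT (ν μ S : ℝ) : Measure ℝ :=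
  ((volume : Measure ℝ).withDensity fun x => ENNReal.ofReal (studentTPDF ν x)).map
    fun x => μ + Real.sqrt S * x

/-- The level preceding `t`, as a subtype: it is empty for the lowest level and has exactly one
element for every other level. -/
abbrev Prev {s : ℕ} (t : Fin s) : Type := {u : Fin s // (u : ℕ) + 1 = (t : ℕ)}

/-- The non-random data of an `s`-level cokriging model on the input space `𝒳`: the hierarchically
nested designs `X t`, the basis functions `h t` (`p t` of them at level `t`) and, at the given
values of the correlation parameters, the correlation functions `r t`. Levels are numbered from
`0`. That `r t` is a symmetric positive semidefinite kernel is part of `IsCokrigingModel` below,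
where it is the covariance function of a process. -/
structure Cokriging (𝒳 : Type*) (s : ℕ) where
  X : Fin s → Finset 𝒳
  nested : ∀ (t : Fin s) (u : Prev t), X t ⊆ X u.1
  p : Fin s → ℕ
  h : (t : Fin s) → 𝒳 → Fin (p t) → ℝ
  r : Fin s → 𝒳 → 𝒳 → ℝ

namespace Cokriging

variable {𝒳 : Type*} {s : ℕ} (C : Cokriging 𝒳 s)

/-- The index set of the columns of `X_t`: the `p t` basis functions, followed (except at the lowest
level) by one column for the output of the preceding level. -/
abbrev Col (t : Fin s) : Type := Fin (C.p t) ⊕ Prev t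

/-- `q_t`, the number of columns of `X_t`. -/
def q (t : Fin s) : ℕ := Fintype.card (C.Col t)

/-- `n_t`, the number of inputs at which level `t` is run. -/
def n (t : Fin s) : ℕ := (C.X t).card

/-- The location-scale parameters: at each level the pair `(b_t, σ_t²)`, where
`b_t = (β_t, γ_{t-1})`, with no `γ` at the lowest level. -/
abbrev Param : Type := (t : Fin s) → (C.Col t → ℝ) × ℝ

/-- The space of all outputs `y = (y_1, …, y_s)` at the design points. -/
abbrev Data : Type _ := (t : Fin s) → C.X t → ℝ

/-- `δ_t = y_t - γ_{t-1} y_{t-1}` (and `δ_1 = y_1`). -/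
def discrepancy {Ω : Type*} (Y : Fin s → 𝒳 → Ω → ℝ) (θ : C.Param) (t : Fin s) (x : 𝒳) (ω : Ω) : ℝ :=
  Y t x ω - ∑ u : Prev t, (θ t).1 (Sum.inr u) * Y u.1 x ω

/-- Under `P`, the processes `Y 0, …, Y (s - 1)` follow the autoregressive cokriging model with
parameters `θ`: `y_t = γ_{t-1} y_{t-1} + δ_t`, where `δ_1 = y_1` and the `δ_t` are independent
Gaussian processes with mean `h_tᵀ β_t` and covariance function `σ_t² r_t`. -/
structure IsCokrigingModel {Ω : Type*} [MeasurableSpace Ω] (Y : Fin s → 𝒳 → Ω → ℝ) (θ : C.Param)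
    (P : Measure Ω) : Prop where
  gaussian : ∀ t, IsGaussianProcess (C.discrepancy Y θ t) P
  mean : ∀ t x, ∫ ω, C.discrepancy Y θ t x ω ∂P = ∑ j, C.h t x j * (θ t).1 (Sum.inl j)
  cov : ∀ t x x', cov[C.discrepancy Y θ t x, C.discrepancy Y θ t x'; P] = (θ t).2 * C.r t x x'
  indep : iIndepFun (fun t ω x => C.discrepancy Y θ t x ω) P

/-- The reference prior: density `∏_t 1 / σ_t²` with respect to Lebesgue measure in
`(b_t, σ_t²) ∈ ℝ^{q_t} × (0, ∞)`, `t = 1, …, s`. -/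
noncomputable def refPrior : Measure C.Param :=
  Measure.pi fun t => (volume : Measure (C.Col t → ℝ)).prod
    (((volume : Measure ℝ).restrict (Set.Ioi 0)).withDensity fun v => ENNReal.ofReal (1 / v))

/-- The (improper) joint law of the data `y` and of `y(x₀) = (y_1(x₀), …, y_s(x₀))`, after
integrating the parameters out with respect to the prior `π`. -/
noncomputable def jointLaw {Ω : Type*} [MeasurableSpace Ω] (Y : Fin s → 𝒳 → Ω → ℝ)
    (P : C.Param → Measure Ω) (π : Measure C.Param) (x₀ : 𝒳) : Measure (C.Data × (Fin s → ℝ)) :=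
  π.bind fun θ => (P θ).map fun ω =>
    ((fun t (x : C.X t) => Y t x ω : C.Data), fun t => Y t x₀ ω)

/-- `H_t = h_t(𝒳_t)`. -/
def H (t : Fin s) : Matrix (C.X t) (Fin (C.p t)) ℝ := Matrix.of fun x => C.h t x

/-- `R_t = r_t(𝒳_t, 𝒳_t)`. -/
def R (t : Fin s) : Matrix (C.X t) (C.X t) ℝ := Matrix.of fun x x' => C.r t x x'

/-- `r_t(x₀) = r_t(𝒳_t, x₀)`. -/
def rvec (t : Fin s) (x₀ : 𝒳) : C.X t → ℝ := fun x => C.r t x x₀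

/-- The outputs of the level preceding `t` (if there is one) at its own design points. -/
abbrev PrevData (t : Fin s) : Type _ := (u : Prev t) → C.X u.1 → ℝ

/-- `X_t = [H_t, y_{t-1}(𝒳_t)]`, and `X_1 = H_1`. -/
def Xmat (t : Fin s) (yp : C.PrevData t) : Matrix (C.X t) (C.Col t) ℝ :=
  Matrix.of fun x => Sum.elim (C.h t x) fun u => yp u ⟨x, C.nested t u x.2⟩

/-- `X_t(x₀) = (h_t(x₀), y_{t-1}(x₀))`, and `X_1(x₀) = h_1(x₀)`; here `w = y_{t-1}(x₀)`. -/
def X0 (t : Fin s) (x₀ : 𝒳) (w : Prev t → ℝ) : C.Col t → ℝ := Sum.elim (C.h t x₀) w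

variable [DecidableEq 𝒳]

/-- The Gram matrix `X_tᵀ R_t⁻¹ X_t`. -/
noncomputable def gram (t : Fin s) (yp : C.PrevData t) : Matrix (C.Col t) (C.Col t) ℝ :=
  (C.Xmat t yp)ᵀ * (C.R t)⁻¹ * C.Xmat t yp

/-- `b̂_t = (X_tᵀ R_t⁻¹ X_t)⁻¹ X_tᵀ R_t⁻¹ y_t`. -/
noncomputable def bhat (t : Fin s) (yp : C.PrevData t) (y : C.X t → ℝ) : C.Col t → ℝ :=
  ((C.gram t yp)⁻¹ * (C.Xmat t yp)ᵀ * (C.R t)⁻¹) *ᵥ y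

/-- The generalized sum of squares `(y_t - X_t b)ᵀ R_t⁻¹ (y_t - X_t b)`. -/
noncomputable def gss (t : Fin s) (yp : C.PrevData t) (y : C.X t → ℝ) (b : C.Col t → ℝ) : ℝ :=
  (y - C.Xmat t yp *ᵥ b) ⬝ᵥ ((C.R t)⁻¹ *ᵥ (y - C.Xmat t yp *ᵥ b))

/-- `σ̂_t² = (y_t - X_t b̂_t)ᵀ R_t⁻¹ (y_t - X_t b̂_t) / (n_t - q_t)`. -/
noncomputable def sigmaHatSq (t : Fin s) (yp : C.PrevData t) (y : C.X t → ℝ) : ℝ :=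
  C.gss t yp y (C.bhat t yp y) / ((C.n t : ℝ) - C.q t)

/-- `μ_t(x₀) = X_t(x₀)ᵀ b̂_t + r_t(x₀)ᵀ R_t⁻¹ (y_t - X_t b̂_t)`. -/
noncomputable def predMean (t : Fin s) (x₀ : 𝒳) (yp : C.PrevData t) (y : C.X t → ℝ)
    (w : Prev t → ℝ) : ℝ :=
  C.X0 t x₀ w ⬝ᵥ C.bhat t yp y +
    C.rvec t x₀ ⬝ᵥ ((C.R t)⁻¹ *ᵥ (y - C.Xmat t yp *ᵥ C.bhat t yp y))

/-- `X_t(x₀) - X_tᵀ R_t⁻¹ r_t(x₀)`. -/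
noncomputable def avec (t : Fin s) (x₀ : 𝒳) (yp : C.PrevData t) (w : Prev t → ℝ) : C.Col t → ℝ :=
  C.X0 t x₀ w - ((C.Xmat t yp)ᵀ * (C.R t)⁻¹) *ᵥ C.rvec t x₀

/-- `c_t* = r_t(x₀, x₀) - r_t(x₀)ᵀ R_t⁻¹ r_t(x₀)
  + [X_t(x₀) - X_tᵀ R_t⁻¹ r_t(x₀)]ᵀ (X_tᵀ R_t⁻¹ X_t)⁻¹ [X_t(x₀) - X_tᵀ R_t⁻¹ r_t(x₀)]`. -/
noncomputable def cstar (t : Fin s) (x₀ : 𝒳) (yp : C.PrevData t) (w : Prev t → ℝ) : ℝ :=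
  C.r t x₀ x₀ - C.rvec t x₀ ⬝ᵥ ((C.R t)⁻¹ *ᵥ C.rvec t x₀) +
    C.avec t x₀ yp w ⬝ᵥ ((C.gram t yp)⁻¹ *ᵥ C.avec t x₀ yp w)

/-- `t_{n_t - q_t}(μ_t(x₀), σ̂_t² c_t*)`, as a function of `y_{t-1}`, `y_t` and
`w = y_{t-1}(x₀)`. -/
noncomputable def levelLaw (t : Fin s) (x₀ : 𝒳) (yp : C.PrevData t) (y : C.X t → ℝ)
    (w : Prev t → ℝ) : Measure ℝ :=
  studentT ((C.n t : ℝ) - C.q t) (C.predMean t x₀ yp y w) (C.sigmaHatSq t yp y * C.cstar t x₀ yp w)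

/-- The law on `ℝ^s` of a vector `v` whose entries are drawn one after the other, level by level:
`v_t` is drawn from `t_{n_t - q_t}(μ_t(x₀), σ̂_t² c_t*)` at `(y_{t-1}, y_t, v_{t-1})`. It is the
measure `∏_t κ_t(dv_t | v_{t-1}, y_{t-1}, y_t)`. -/
noncomputable def chainLaw (x₀ : 𝒳) (y : C.Data) : Measure (Fin s → ℝ) :=
  Fin.foldl s
    (fun μ t => μ.bind fun v =>
      (C.levelLaw t x₀ (fun u => y u.1) (y t) (fun u => v u.1)).map (Function.update v t))
    (Measure.dirac 0)

end Cokriging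

/-! At known parameters, the residuals `y_t - X_t b_t` on the design, together with their analogues
at `x₀`, are the centered discrepancies: independent between levels and jointly Gaussian within a
level. The outputs determine them by a triangular map in which each output enters its own residual
with coefficient one, so the map is injective and its design part preserves volume. Gaussian
regression within each level (`HasGaussianLaw.lintegral_regression`) then gives the law of `(y,
y(x₀))` as a product of level densities in `y`, followed by a chain of Gaussian kriging kernels
(`IsCokrigingModel.map_outputs`).

The density factor and the kernel of level `t` involve only the parameters of level `t`, and the
prior is a product. By Tonelli the parameters can therefore be integrated out one link at a time
(`lmarginal_lintegral_chainKer`). Within a link, completing the square (`gss_eq`) makes `b` Gaussian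
around `b̂_t`. Since the kriging mean is affine in `b` with slope `a_t`, integrating over `b`
enlarges the relative variance to `c_t*`. What remains in `v = σ_t²`, including the prior factor `1
/ v`, is an inverse gamma weight of shape `(n_t - q_t) / 2`, and such a mixture of Gaussians is the
Student law (`lintegral_gaussianReal_mixture`). These computations are combined in
`exists_lintegral_levelDens`.

They are valid for non-degenerate data, and degenerate data lie in null sets cut out by proper
subspaces (`ae_nondegenerate`). Hence the joint law is `M ⊗ₘ predictive`, where `M` has an almost
everywhere positive and finite density (`exists_jointLaw_eq_compProd`). Conditioning on the lower
levels as well only requires that the later links are Markov and leave earlier coordinates alone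
(`isCondKernel_sequentialKer`). -/

/-! ### Matrix factorizations, product integrals and Gaussian vectors -/

open scoped MatrixOrder in
theorem Matrix.PosSemidef.exists_eq_transpose_mul_self {ι : Type*} [Fintype ι]
    {M : Matrix ι ι ℝ} (hM : M.PosSemidef) : ∃ A : Matrix ι ι ℝ, M = Aᵀ * A := by
  classical
  obtain ⟨A, rfl⟩ := CStarAlgebra.nonneg_iff_eq_star_mul_self.mp hM.nonneg
  exact ⟨A, by rw [Matrix.star_eq_conjTranspose, Matrix.conjTranspose_eq_transpose_of_trivial]⟩

/-- Supplies the whitening matrices for `R_t⁻¹` and for the Gram matrix; any invertible factor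
serves, symmetric or not. -/
theorem Matrix.PosDef.exists_isUnit_det_eq_transpose_mul_self {ι : Type*} [Fintype ι]
    [DecidableEq ι] {M : Matrix ι ι ℝ} (hM : M.PosDef) :
    ∃ A : Matrix ι ι ℝ, IsUnit A.det ∧ M = Aᵀ * A := by
  obtain ⟨A, rfl⟩ := hM.posSemidef.exists_eq_transpose_mul_self
  refine ⟨A, ?_, rfl⟩
  have := hM.det_pos.ne'
  rw [Matrix.det_mul] at this
  exact (right_ne_zero_of_mul this).isUnit

/-- Tonelli for a product of functions of the single coordinates. -/
theorem lintegral_pi_prod {ι : Type*} [Fintype ι] [DecidableEq ι] {E : ι → Type*}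
    [∀ i, MeasurableSpace (E i)] (μ : ∀ i, Measure (E i)) [∀ i, SigmaFinite (μ i)]
    {f : ∀ i, E i → ℝ≥0∞} (hf : ∀ i, Measurable (f i)) :
    ∫⁻ x, ∏ i, f i (x i) ∂Measure.pi μ = ∏ i, ∫⁻ x, f i x ∂μ i := by
  by_cases hne : Nonempty (∀ i, E i)
  swap
  · rw [not_nonempty_iff] at hne
    obtain ⟨i, hi⟩ := isEmpty_pi.mp hne
    rw [lintegral_of_isEmpty, eq_comm]
    exact Finset.prod_eq_zero (Finset.mem_univ i) (lintegral_of_isEmpty _ _)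
  obtain ⟨x₀⟩ := hne
  rw [lintegral_eq_lmarginal_univ x₀]
  -- Partial integrals over a subset of the coordinates make an induction on that subset possible;
  -- the full set is the claim.
  have key : ∀ s : Finset ι, ∀ x, (∫⋯∫⁻_s, (fun x => ∏ i ∈ s, f i (x i)) ∂μ) x =
      ∏ i ∈ s, ∫⁻ x, f i x ∂μ i := by
    intro s
    induction s using Finset.induction_on with
    | empty => intro x; simp
    | insert i s hi ih =>
      intro x
      have hm : Measurable fun x : ∀ i, E i => ∏ j ∈ insert i s, f j (x j) :=
        Finset.measurable_prod _ fun j _ => (hf j).comp (measurable_pi_apply j)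
      rw [lmarginal_insert' _ hm hi, Finset.prod_insert hi, ← ih x]
      have : (fun x : ∀ i, E i => ∫⁻ xi, ∏ j ∈ insert i s, f j (Function.update x i xi j) ∂μ i) =
          fun x => (∫⁻ y, f i y ∂μ i) * ∏ j ∈ s, f j (x j) := by
        ext x
        rw [← lintegral_mul_const _ (hf i)]
        refine lintegral_congr fun xi => ?_
        rw [Finset.prod_insert hi, Function.update_self]
        congr 1
        refine Finset.prod_congr rfl fun j hj => ?_
        rw [Function.update_of_ne (by rintro rfl; exact hi hj)]
      rw [this, lmarginal, lintegral_const_mul]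
      · rfl
      · exact (Finset.measurable_prod _ fun j _ =>
          (hf j).comp (measurable_pi_apply j)).comp measurable_updateFinset
  exact key _ _

/-- Linear change of variables. -/
theorem lintegral_comp_mulVec {ι : Type*} [Fintype ι] [DecidableEq ι] {A : Matrix ι ι ℝ}
    (hA : IsUnit A.det) {F : (ι → ℝ) → ℝ≥0∞} (hF : Measurable F) :
    ENNReal.ofReal |A.det| * ∫⁻ e, F (A *ᵥ e) = ∫⁻ w, F w := by
  have h := Real.map_matrix_volume_pi_eq_smul_volume_pi hA.ne_zero
  have hm : Measurable (Matrix.toLin' A) := (LinearMap.continuous_of_finiteDimensional _).measurable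
  have h2 : ∫⁻ e, F (A *ᵥ e) = ENNReal.ofReal |A.det⁻¹| * ∫⁻ w, F w := by
    rw [← smul_eq_mul, ← lintegral_smul_measure, ← h, lintegral_map hF hm]
    rfl
  rw [h2, ← mul_assoc, ← ENNReal.ofReal_mul (abs_nonneg _), ← abs_mul,
    mul_inv_cancel₀ hA.ne_zero]
  simp

theorem pi_withDensity {ι : Type*} [Fintype ι] [DecidableEq ι] {E : ι → Type*}
    [∀ i, MeasurableSpace (E i)] (μ : ∀ i, Measure (E i)) [∀ i, SigmaFinite (μ i)]
    {f : ∀ i, E i → ℝ≥0∞} (hf : ∀ i, Measurable (f i))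
    [∀ i, SigmaFinite ((μ i).withDensity (f i))] :
    Measure.pi (fun i => (μ i).withDensity (f i)) =
      (Measure.pi μ).withDensity fun x => ∏ i, f i (x i) := by
  refine Measure.pi_eq fun s hs => ?_
  have hS : MeasurableSet (Set.univ.pi s) := MeasurableSet.univ_pi hs
  rw [withDensity_apply _ hS, ← lintegral_indicator hS]
  have : (Set.univ.pi s).indicator (fun x => ∏ i, f i (x i)) =
      fun x => ∏ i, (s i).indicator (f i) (x i) := by
    ext x
    by_cases hx : x ∈ Set.univ.pi s
    · rw [Set.indicator_of_mem hx]
      exact Finset.prod_congr rfl fun i _ => (Set.indicator_of_mem (hx i trivial) _).symm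
    · rw [Set.indicator_of_notMem hx]
      simp only [Set.mem_pi, Set.mem_univ, forall_const, not_forall] at hx
      obtain ⟨i, hi⟩ := hx
      exact (Finset.prod_eq_zero (Finset.mem_univ i) (Set.indicator_of_notMem hi _)).symm
  rw [this, lintegral_pi_prod μ fun i => (hf i).indicator (hs i)]
  exact Finset.prod_congr rfl fun i _ => by
    rw [withDensity_apply _ (hs i), lintegral_indicator (hs i)]

theorem lintegral_pi_gaussianReal {ι : Type*} [Fintype ι] [DecidableEq ι] {v : NNReal} (hv : v ≠ 0)
    {F : (ι → ℝ) → ℝ≥0∞} (hF : Measurable F) :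
    ∫⁻ w, F w ∂(Measure.pi fun _ : ι => gaussianReal 0 v) =
      ∫⁻ w, (∏ i, gaussianPDF 0 v (w i)) * F w := by
  have h : (Measure.pi fun _ : ι => gaussianReal 0 v) =
      (volume : Measure (ι → ℝ)).withDensity fun w => ∏ i, gaussianPDF 0 v (w i) := by
    have : SigmaFinite ((volume : Measure ℝ).withDensity (gaussianPDF 0 v)) := by
      rw [← gaussianReal_of_var_ne_zero 0 hv]; infer_instance
    have h := pi_withDensity (fun _ : ι => (volume : Measure ℝ)) (f := fun _ => gaussianPDF 0 v)
      fun _ => measurable_gaussianPDF 0 v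
    rw [volume_pi, ← h]
    simp only [gaussianReal_of_var_ne_zero 0 hv]
  rw [h, lintegral_withDensity_eq_lintegral_mul _ _ hF]
  · rfl
  · exact Finset.measurable_prod _ fun i _ =>
      (measurable_gaussianPDF 0 v).comp (measurable_pi_apply i)

/-- A sum of independent Gaussians is Gaussian, so only its mean and its variance have to be
computed. -/
theorem map_dotProduct_pi_gaussianReal {ι : Type*} [Fintype ι] (v : NNReal) (c : ι → ℝ) :
    (Measure.pi fun _ : ι => gaussianReal 0 v).map (fun w => c ⬝ᵥ w) =
      gaussianReal 0 (v * Real.toNNReal (c ⬝ᵥ c)) := by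
  have hind : iIndepFun (fun (i : ι) (w : ι → ℝ) => c i * w i)
      (Measure.pi fun _ : ι => gaussianReal 0 v) :=
    iIndepFun_pi (X := fun i (x : ℝ) => c i * x) fun i => by fun_prop
  have hlaw : ∀ i, (Measure.pi fun _ : ι => gaussianReal 0 v).map (fun w => c i * w i) =
      gaussianReal 0 (.mk (c i ^ 2) (sq_nonneg _) * v) := fun i => by
    have : (fun w : ι → ℝ => c i * w i) = (fun x => c i * x) ∘ Function.eval i := rfl
    rw [this, ← Measure.map_map (g := fun x => c i * x) (by fun_prop) (measurable_pi_apply i),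
      (measurePreserving_eval _ i).map_eq, gaussianReal_map_const_mul, mul_zero]
  have hG : ∀ i, HasGaussianLaw (fun w : ι → ℝ => c i * w i)
      (Measure.pi fun _ : ι => gaussianReal 0 v) := fun i => ⟨by rw [hlaw]; infer_instance⟩
  have hsum := hind.hasGaussianLaw_fun_sum hG
  have hE : (fun w : ι → ℝ => c ⬝ᵥ w) = fun w => ∑ i, c i * w i := rfl
  have hint : ∀ i, Integrable (fun w : ι → ℝ => c i * w i)
      (Measure.pi fun _ : ι => gaussianReal 0 v) := fun i => (hG i).integrable
  have hX : ∀ i, Measurable fun w : ι → ℝ => c i * w i := fun i => by fun_prop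
  have hmean : ∀ i, ∫ w, c i * w i ∂(Measure.pi fun _ : ι => gaussianReal 0 v) = 0 := fun i => by
    have := integral_map (hX i).aemeasurable (f := fun x => x)
      (μ := Measure.pi fun _ : ι => gaussianReal 0 v) (by fun_prop)
    rw [← this, hlaw, integral_id_gaussianReal]
  have hvar : ∀ i, Var[fun w => c i * w i; Measure.pi fun _ : ι => gaussianReal 0 v] =
      c i ^ 2 * v := fun i => by
    have := variance_map (X := id) (Y := fun w : ι → ℝ => c i * w i)
      (μ := Measure.pi fun _ : ι => gaussianReal 0 v) aemeasurable_id (hX i).aemeasurable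
    rw [hlaw, variance_id_gaussianReal] at this
    simpa using this.symm
  rw [hE, hsum.map_eq_gaussianReal, integral_finsetSum _ fun i _ => hint i]
  simp only [hmean, Finset.sum_const_zero]
  congr 1
  have hv := IndepFun.variance_sum (s := Finset.univ) (X := fun i (w : ι → ℝ) => c i * w i)
    (fun i _ => (hG i).memLp_two) fun i _ j _ hij => hind.indepFun hij
  have hE2 : (fun w : ι → ℝ => ∑ i, c i * w i) = ∑ i, fun w : ι → ℝ => c i * w i := by
    ext w; simp
  rw [hE2, hv]
  simp only [hvar]
  rw [← Finset.sum_mul, mul_comm, Real.toNNReal_mul v.coe_nonneg, Real.toNNReal_coe]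
  simp only [dotProduct, sq]

/-! ### Inverse gamma mixtures and the Student distribution -/

theorem lintegral_rpow_mul_exp_neg_mul_Ioi {a b : ℝ} (ha : 0 < a) (hb : 0 < b) :
    ∫⁻ x in Set.Ioi (0 : ℝ), ENNReal.ofReal (x ^ (a - 1) * Real.exp (-(b * x))) =
      ENNReal.ofReal (Real.Gamma a * b ^ (-a)) := by
  have hΓ := Real.Gamma_pos_of_pos ha
  rw [← ofReal_integral_eq_lintegral_ofReal]
  · rw [Real.integral_rpow_mul_exp_neg_mul_Ioi ha hb, one_div, Real.inv_rpow hb.le,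
      Real.rpow_neg hb.le, mul_comm]
  · refine Integrable.of_integral_ne_zero ?_
    rw [Real.integral_rpow_mul_exp_neg_mul_Ioi ha hb]
    positivity
  · filter_upwards [self_mem_ae_restrict measurableSet_Ioi] with x hx
    have : 0 < x := hx
    positivity

/-- The total mass of the unnormalized inverse gamma density. -/
theorem lintegral_rpow_mul_exp_neg_div_Ioi {a b : ℝ} (ha : 0 < a) (hb : 0 < b) :
    ∫⁻ v in Set.Ioi (0 : ℝ), ENNReal.ofReal (v ^ (-a - 1) * Real.exp (-(b / v))) =
      ENNReal.ofReal (Real.Gamma a * b ^ (-a)) := by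
  -- The substitution `v = 1 / x` reduces the inverse gamma integral to the gamma integral.
  have himg : (fun x : ℝ => x⁻¹) '' Set.Ioi 0 = Set.Ioi 0 := by
    ext x
    constructor
    · rintro ⟨y, hy, rfl⟩
      exact inv_pos.mpr (Set.mem_Ioi.mp hy)
    · intro hx
      exact ⟨x⁻¹, Set.mem_Ioi.mpr (inv_pos.mpr (Set.mem_Ioi.mp hx)), inv_inv x⟩
  rw [← lintegral_rpow_mul_exp_neg_mul_Ioi ha hb]
  conv_lhs => rw [← himg]
  rw [lintegral_image_eq_lintegral_abs_deriv_mul (f' := fun x => -(x ^ 2)⁻¹) measurableSet_Ioi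
    (fun x hx => (hasDerivAt_inv (ne_of_gt hx)).hasDerivWithinAt) inv_injective.injOn]
  refine setLIntegral_congr_fun measurableSet_Ioi fun x hx => ?_
  have hx' : 0 < x := hx
  rw [← ENNReal.ofReal_mul (abs_nonneg _), abs_neg, abs_of_pos (by positivity), div_inv_eq_mul,
    ← mul_assoc]
  congr 2
  rw [Real.inv_rpow hx'.le, ← Real.rpow_neg hx'.le, ← Real.rpow_natCast, ← Real.rpow_neg hx'.le,
    ← Real.rpow_add hx']
  congr 1
  push_cast
  ring

theorem measurable_studentTPDF (ν : ℝ) : Measurable (studentTPDF ν) := by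
  unfold studentTPDF
  fun_prop

/-- Real powers in place of square roots let the powers of `v` merge with an inverse gamma weight.
-/
theorem gaussianPDF_zero_toNNReal {v : ℝ} (hv : 0 < v) (x : ℝ) :
    gaussianPDF 0 v.toNNReal x =
      ENNReal.ofReal ((2 * Real.pi * v) ^ (-(1 / 2) : ℝ) * Real.exp (-(x ^ 2 / 2 / v))) := by
  rw [gaussianPDF, gaussianPDFReal, Real.coe_toNNReal _ hv.le, Real.sqrt_eq_rpow,
    ← Real.rpow_neg (by positivity), sub_zero]
  congr 3
  field_simp

theorem lintegral_studentT {ν μ S : ℝ} {G : ℝ → ℝ≥0∞} (hG : Measurable G) :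
    ∫⁻ x, G x ∂studentT ν μ S =
      ∫⁻ x, ENNReal.ofReal (studentTPDF ν x) * G (μ + Real.sqrt S * x) := by
  rw [studentT, lintegral_map hG (by fun_prop),
    lintegral_withDensity_eq_lintegral_mul _ (measurable_studentTPDF ν).ennreal_ofReal
      (by fun_prop)]
  rfl

theorem lintegral_comp_mul_left_pos {c : ℝ} (hc : 0 < c) (f : ℝ → ℝ≥0∞) :
    ∫⁻ x, f x = ENNReal.ofReal c * ∫⁻ x, f (c * x) := by
  have h := lintegral_image_eq_lintegral_abs_deriv_mul (s := Set.univ) (f := fun x => c * x)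
    (f' := fun _ => c) MeasurableSet.univ
    (fun x _ => by simpa using ((hasDerivAt_id' x).const_mul c).hasDerivWithinAt (s := Set.univ))
    (mul_right_injective₀ hc.ne').injOn f
  rw [Set.image_univ, (mul_left_surjective₀ hc.ne').range_eq, Measure.restrict_univ,
    lintegral_const_mul' _ _ ENNReal.ofReal_ne_top, abs_of_pos hc] at h
  exact h

/-- The product of the two densities is again of inverse gamma form in `v`, with shape `(ν + 1) / 2`
and scale `S / 2 * (1 + x ^ 2 / ν)`; the power of that scale is the Student density up to constants.
The last factor `√(S / ν)` is the Jacobian of the rescaling of `x`. -/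
theorem studentTPDF_mixture {ν S : ℝ} (hν : 0 < ν) (hS : 0 < S) (x : ℝ) :
    ∫⁻ v in Set.Ioi (0 : ℝ), ENNReal.ofReal (v ^ (-(ν / 2) - 1) * Real.exp (-(S / 2 / v))) *
        gaussianPDF 0 v.toNNReal (Real.sqrt (S / ν) * x) * ENNReal.ofReal (Real.sqrt (S / ν)) =
      ENNReal.ofReal (Real.Gamma (ν / 2) * (S / 2) ^ (-(ν / 2))) *
        ENNReal.ofReal (studentTPDF ν x) := by
  have hx : 0 < 1 + x ^ 2 / ν := by positivity
  have h1 : ∫⁻ v in Set.Ioi (0 : ℝ), ENNReal.ofReal (v ^ (-(ν / 2) - 1) *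
        Real.exp (-(S / 2 / v))) * gaussianPDF 0 v.toNNReal (Real.sqrt (S / ν) * x) *
        ENNReal.ofReal (Real.sqrt (S / ν)) =
      ∫⁻ v in Set.Ioi (0 : ℝ), ENNReal.ofReal
        (v ^ (-((ν + 1) / 2) - 1) * Real.exp (-(S / 2 * (1 + x ^ 2 / ν) / v))) *
        ENNReal.ofReal ((2 * Real.pi) ^ (-(1 / 2) : ℝ) * Real.sqrt (S / ν)) := by
    refine setLIntegral_congr_fun measurableSet_Ioi fun v hv => ?_
    have hv' : 0 < v := hv
    rw [gaussianPDF_zero_toNNReal hv', ← ENNReal.ofReal_mul (by positivity),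
      ← ENNReal.ofReal_mul (by positivity), ← ENNReal.ofReal_mul (by positivity)]
    congr 1
    rw [Real.mul_rpow (by positivity) hv'.le]
    have e1 : v ^ (-((ν + 1) / 2) - 1) = v ^ (-(ν / 2) - 1) * v ^ (-(1 / 2) : ℝ) := by
      rw [← Real.rpow_add hv']; congr 1; ring
    have e2 : Real.exp (-(S / 2 * (1 + x ^ 2 / ν) / v)) = Real.exp (-(S / 2 / v)) *
        Real.exp (-((Real.sqrt (S / ν) * x) ^ 2 / 2 / v)) := by
      rw [← Real.exp_add, mul_pow, Real.sq_sqrt (by positivity)]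
      congr 1
      field_simp
      ring
    rw [e1, e2]
    ring
  rw [h1, lintegral_mul_const' _ _ ENNReal.ofReal_ne_top,
    lintegral_rpow_mul_exp_neg_div_Ioi (by positivity) (by positivity),
    ← ENNReal.ofReal_mul (by have := Real.Gamma_pos_of_pos (s := (ν + 1) / 2) (by positivity);
                             positivity),
    ← ENNReal.ofReal_mul (by have := Real.Gamma_pos_of_pos (s := ν / 2) (by positivity);
                             positivity)]
  congr 1
  have hΓ := (Real.Gamma_pos_of_pos (s := ν / 2) (by positivity)).ne'
  have e3 : (S / 2) ^ (-((ν + 1) / 2)) = (S / 2) ^ (-(ν / 2)) * (Real.sqrt (S / 2))⁻¹ := by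
    rw [Real.sqrt_eq_rpow, ← Real.rpow_neg (by positivity), ← Real.rpow_add (by positivity)]
    congr 1; ring
  have e4 : (2 * Real.pi) ^ (-(1 / 2) : ℝ) = (Real.sqrt (2 * Real.pi))⁻¹ := by
    rw [Real.sqrt_eq_rpow, ← Real.rpow_neg (by positivity)]
  rw [studentTPDF, Real.mul_rpow (by positivity) hx.le, e3, e4, Real.sqrt_div hS.le,
    Real.sqrt_div hS.le, Real.sqrt_mul (by positivity), Real.sqrt_mul hν.le]
  have := Real.sqrt_pos.mpr hS
  have := Real.sqrt_pos.mpr hν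
  have := Real.sqrt_pos.mpr Real.pi_pos
  field_simp

/-- The Student distribution is the inverse gamma mixture of centered Gaussian distributions. -/
theorem lintegral_gaussianReal_mixture {ν S : ℝ} (hν : 0 < ν) (hS : 0 < S) {G : ℝ → ℝ≥0∞}
    (hG : Measurable G) :
    ∫⁻ v in Set.Ioi (0 : ℝ), ENNReal.ofReal (v ^ (-(ν / 2) - 1) * Real.exp (-(S / 2 / v))) *
        ∫⁻ x, G x ∂gaussianReal 0 v.toNNReal =
      ENNReal.ofReal (Real.Gamma (ν / 2) * (S / 2) ^ (-(ν / 2))) *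
        ∫⁻ x, G x ∂studentT ν 0 (S / ν) := by
  set σ := Real.sqrt (S / ν) with hσ
  have hσ0 : 0 < σ := Real.sqrt_pos.mpr (by positivity)
  have hgm : Measurable fun p : ℝ × ℝ => gaussianPDF 0 p.1.toNNReal (σ * p.2) :=
    measurable_uncurry_gaussianPDF.comp (f := fun p : ℝ × ℝ => (0, p.1.toNNReal, σ * p.2))
      (by fun_prop)
  have h1 : ∀ v ∈ Set.Ioi (0 : ℝ),
      ENNReal.ofReal (v ^ (-(ν / 2) - 1) * Real.exp (-(S / 2 / v))) *
        ∫⁻ x, G x ∂gaussianReal 0 v.toNNReal =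
      ∫⁻ x, ENNReal.ofReal (v ^ (-(ν / 2) - 1) * Real.exp (-(S / 2 / v))) *
        gaussianPDF 0 v.toNNReal (σ * x) * ENNReal.ofReal σ * G (σ * x) := by
    intro v hv
    have hv' : v.toNNReal ≠ 0 := (Real.toNNReal_pos.mpr hv).ne'
    rw [gaussianReal_of_var_ne_zero _ hv', lintegral_withDensity_eq_lintegral_mul _
      (measurable_gaussianPDF _ _) hG, lintegral_comp_mul_left_pos hσ0, ← mul_assoc,
      ← lintegral_const_mul' _ _ (by finiteness)]
    refine lintegral_congr fun x => ?_
    simp only [Pi.mul_apply]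
    ring
  rw [setLIntegral_congr_fun measurableSet_Ioi h1, lintegral_lintegral_swap]
  swap
  · refine Measurable.aemeasurable ?_
    simp only [Function.uncurry_def]
    fun_prop
  rw [lintegral_studentT hG, ← lintegral_const_mul' _ _ ENNReal.ofReal_ne_top]
  refine lintegral_congr fun x => ?_
  rw [lintegral_mul_const, studentTPDF_mixture hν hS x, zero_add, mul_assoc]
  have : Measurable fun v : ℝ => gaussianPDF 0 v.toNNReal (σ * x) :=
    hgm.comp (measurable_id.prodMk measurable_const)
  fun_prop

/-- Test the mixture identity on the constant `1`: the inverse gamma mass appears on both sides and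
cancels, being positive and finite. -/
theorem isProbabilityMeasure_withDensity_studentTPDF {ν : ℝ} (hν : 0 < ν) :
    IsProbabilityMeasure
      ((volume : Measure ℝ).withDensity fun x => ENNReal.ofReal (studentTPDF ν x)) := by
  have h := lintegral_gaussianReal_mixture hν hν (G := fun _ => 1) measurable_const
  have hΓ := Real.Gamma_pos_of_pos (s := ν / 2) (by positivity)
  simp only [lintegral_const, measure_univ, mul_one, one_mul] at h
  rw [lintegral_rpow_mul_exp_neg_div_Ioi (by positivity) (by positivity)] at h
  have h2 : studentT ν 0 (ν / ν) Set.univ = 1 := by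
    refine ((ENNReal.mul_right_inj ?_ ENNReal.ofReal_ne_top).mp (h.symm.trans (mul_one _).symm))
    rw [ENNReal.ofReal_ne_zero_iff]
    positivity
  rw [studentT, Measure.map_apply (by fun_prop) MeasurableSet.univ, Set.preimage_univ] at h2
  exact ⟨h2⟩

theorem isProbabilityMeasure_studentT {ν : ℝ} (hν : 0 < ν) (μ S : ℝ) :
    IsProbabilityMeasure (studentT ν μ S) := by
  have := isProbabilityMeasure_withDensity_studentTPDF hν
  exact Measure.isProbabilityMeasure_map (by fun_prop)

/-- Location-scale form of the mixture representation. -/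
theorem lintegral_gaussianReal_mixture_affine {ν S c μ : ℝ} (hν : 0 < ν) (hS : 0 < S)
    (hc : 0 ≤ c) {G : ℝ → ℝ≥0∞} (hG : Measurable G) :
    ∫⁻ v in Set.Ioi (0 : ℝ), ENNReal.ofReal (v ^ (-(ν / 2) - 1) * Real.exp (-(S / 2 / v))) *
        ∫⁻ x, G x ∂gaussianReal μ (v * c).toNNReal =
      ENNReal.ofReal (Real.Gamma (ν / 2) * (S / 2) ^ (-(ν / 2))) *
        ∫⁻ x, G x ∂studentT ν μ (S / ν * c) := by
  have h := lintegral_gaussianReal_mixture hν hS (G := fun x => G (μ + Real.sqrt c * x))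
    (by fun_prop)
  have e : ∫⁻ x, G (μ + Real.sqrt c * x) ∂studentT ν 0 (S / ν) =
      ∫⁻ x, G x ∂studentT ν μ (S / ν * c) := by
    rw [lintegral_studentT (by fun_prop), lintegral_studentT hG]
    refine lintegral_congr fun x => ?_
    rw [zero_add, mul_comm (S / ν), Real.sqrt_mul hc, mul_assoc]
  rw [← e, ← h]
  refine setLIntegral_congr_fun measurableSet_Ioi fun v hv => ?_
  have hv' : 0 < v := hv
  congr 1
  have hmap : (gaussianReal 0 v.toNNReal).map (fun x => μ + Real.sqrt c * x) =
      gaussianReal μ (v * c).toNNReal := by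
    have hcomp : (fun x => μ + Real.sqrt c * x) = (fun x => μ + x) ∘ fun x => Real.sqrt c * x := rfl
    rw [hcomp, ← Measure.map_map (by fun_prop) (by fun_prop), gaussianReal_map_const_mul,
      gaussianReal_map_const_add]
    congr 1
    · simp
    · ext
      simp [Real.sq_sqrt hc, hv'.le, hc, mul_nonneg, mul_comm]
  rw [← hmap, lintegral_map hG (by fun_prop)]

/-! ### Chains of kernels that resample one coordinate at a time -/

section ChainKernel

variable {A ι : Type*} [MeasurableSpace A] [DecidableEq ι] {Z : ι → Type*}
  [∀ i, MeasurableSpace (Z i)]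

/-- Resample the coordinate `t` of a vector from the kernel `k`. -/
noncomputable def resample (t : ι) (k : Kernel (A × ∀ i, Z i) (Z t)) :
    Kernel (A × ∀ i, Z i) (A × ∀ i, Z i) :=
  (Kernel.id ×ₖ k).map fun p => (p.1.1, Function.update p.1.2 t p.2)

theorem measurable_prodMk_update (t : ι) :
    Measurable fun p : (A × ∀ i, Z i) × Z t => (p.1.1, Function.update p.1.2 t p.2) := by
  refine (by fun_prop : Measurable fun p : (A × ∀ i, Z i) × Z t => p.1.1).prodMk ?_
  exact measurable_update'.comp
    ((by fun_prop : Measurable fun p : (A × ∀ i, Z i) × Z t => (p.1.2, p.2)))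

instance (t : ι) (k : Kernel (A × ∀ i, Z i) (Z t)) [IsSFiniteKernel k] :
    IsSFiniteKernel (resample t k) := by
  unfold resample; infer_instance

instance (t : ι) (k : Kernel (A × ∀ i, Z i) (Z t)) [IsMarkovKernel k] :
    IsMarkovKernel (resample t k) :=
  Kernel.IsMarkovKernel.map _ (measurable_prodMk_update t)

theorem lintegral_resample (t : ι) (k : Kernel (A × ∀ i, Z i) (Z t)) [IsSFiniteKernel k]
    {F : A × (∀ i, Z i) → ℝ≥0∞} (hF : Measurable F) (a : A) (v : ∀ i, Z i) :
    ∫⁻ p, F p ∂resample t k (a, v) = ∫⁻ x, F (a, Function.update v t x) ∂k (a, v) := by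
  rw [resample, Kernel.lintegral_map _ (measurable_prodMk_update t) _ hF,
    Kernel.lintegral_id_prod
      (f := fun p : (A × ∀ i, Z i) × Z t => F (p.1.1, Function.update p.1.2 t p.2))
      (hF.comp (measurable_prodMk_update t))]

/-- Resample the coordinates in the list `l` one after the other, from the kernels `k t`. -/
noncomputable def chainKer (k : ∀ t, Kernel (A × ∀ i, Z i) (Z t)) :
    List ι → Kernel (A × ∀ i, Z i) (∀ i, Z i)
  | [] => Kernel.deterministic Prod.snd measurable_snd
  | t :: l => chainKer k l ∘ₖ resample t (k t)

variable (k : ∀ t, Kernel (A × ∀ i, Z i) (Z t))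

instance isSFiniteKernel_chainKer [∀ t, IsSFiniteKernel (k t)] :
    ∀ l, IsSFiniteKernel (chainKer k l)
  | [] => by unfold chainKer; infer_instance
  | t :: l => by
    have : IsSFiniteKernel (chainKer k l) := isSFiniteKernel_chainKer l
    unfold chainKer; infer_instance

theorem isMarkovKernel_chainKer [∀ t, IsMarkovKernel (k t)] : ∀ l, IsMarkovKernel (chainKer k l)
  | [] => by unfold chainKer; infer_instance
  | t :: l => by
    have := isMarkovKernel_chainKer l
    unfold chainKer; infer_instance

theorem lintegral_chainKer_nil {F : (∀ i, Z i) → ℝ≥0∞} (hF : Measurable F) (a : A)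
    (v : ∀ i, Z i) : ∫⁻ w, F w ∂chainKer k [] (a, v) = F v := by
  rw [chainKer, Kernel.lintegral_deterministic' _ hF]

variable [∀ t, IsSFiniteKernel (k t)]

theorem lintegral_chainKer_cons (t : ι) (l : List ι) {F : (∀ i, Z i) → ℝ≥0∞} (hF : Measurable F)
    (a : A) (v : ∀ i, Z i) :
    ∫⁻ w, F w ∂chainKer k (t :: l) (a, v) =
      ∫⁻ x, ∫⁻ w, F w ∂chainKer k l (a, Function.update v t x) ∂k t (a, v) := by
  rw [chainKer, Kernel.lintegral_comp _ _ _ hF, lintegral_resample t (k t) hF.lintegral_kernel]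

theorem lintegral_chainKer_append (l l' : List ι) {F : (∀ i, Z i) → ℝ≥0∞} (hF : Measurable F)
    (a : A) (v : ∀ i, Z i) :
    ∫⁻ w, F w ∂chainKer k (l ++ l') (a, v) =
      ∫⁻ u, ∫⁻ w, F w ∂chainKer k l' (a, u) ∂chainKer k l (a, v) := by
  have hm : Measurable fun u => ∫⁻ w, F w ∂chainKer k l' (a, u) :=
    hF.lintegral_kernel.comp measurable_prodMk_left
  induction l generalizing v with
  | nil => rw [List.nil_append, lintegral_chainKer_nil k hm]
  | cons t l ih =>
    rw [List.cons_append, lintegral_chainKer_cons k _ _ hF, lintegral_chainKer_cons k _ _ hm]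
    exact lintegral_congr fun x => ih _

/-- Resampling does not change a function of the other coordinates. -/
theorem lintegral_chainKer_of_forall_update [∀ t, IsMarkovKernel (k t)] (l : List ι)
    {F : (∀ i, Z i) → ℝ≥0∞} (hF : Measurable F)
    (h : ∀ t ∈ l, ∀ v x, F (Function.update v t x) = F v) (a : A) (v : ∀ i, Z i) :
    ∫⁻ w, F w ∂chainKer k l (a, v) = F v := by
  induction l generalizing v with
  | nil => exact lintegral_chainKer_nil k hF a v
  | cons t l ih =>
    rw [lintegral_chainKer_cons k _ _ hF]
    have : ∀ x, ∫⁻ w, F w ∂chainKer k l (a, Function.update v t x) = F v := fun x => by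
      rw [ih (fun u hu => h u (List.mem_cons_of_mem _ hu)), h t List.mem_cons_self]
    simp only [this, lintegral_const, measure_univ, mul_one]

/-- With constant kernels a chain is an iterated integral. Lebesgue measure on the data can thus be
handled by the same chain lemmas as the predictive laws. -/
theorem lintegral_chainKer_const [Fintype ι] (μ : ∀ t, Measure (Z t)) [∀ t, SigmaFinite (μ t)]
    (l : List ι) (hl : l.Nodup) {F : (∀ i, Z i) → ℝ≥0∞} (hF : Measurable F) (a : A)
    (v : ∀ i, Z i) :
    ∫⁻ w, F w ∂chainKer (fun t => Kernel.const (A × ∀ i, Z i) (μ t)) l (a, v) =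
      (∫⋯∫⁻_l.toFinset, F ∂μ) v := by
  induction l generalizing v with
  | nil => rw [lintegral_chainKer_nil _ hF]; simp
  | cons t l ih =>
    have hl' := List.nodup_cons.mp hl
    rw [lintegral_chainKer_cons _ _ _ hF, List.toFinset_cons,
      lmarginal_insert _ hF (by simpa using hl'.1)]
    simp only [Kernel.const_apply]
    exact lintegral_congr fun x => ih hl'.2 _

/-- Integrating, along a chain over a linear order, a product of factors the `t`-th of which is
unaffected by the later coordinates and has a constant integral in its own coordinate. -/
theorem lintegral_chainKer_prod {s : ℕ} {Z : Fin s → Type*} [∀ i, MeasurableSpace (Z i)]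
    (k : ∀ t, Kernel (A × ∀ i, Z i) (Z t)) [∀ t, IsSFiniteKernel (k t)]
    {f : Fin s → (∀ i, Z i) → ℝ≥0∞} (hf : ∀ t, Measurable (f t))
    (hfu : ∀ u t, u < t → ∀ v x, f u (Function.update v t x) = f u v) (a : A)
    {c : Fin s → ℝ≥0∞} (hc : ∀ t v, ∫⁻ x, f t (Function.update v t x) ∂k t (a, v) = c t)
    (v : ∀ i, Z i) :
    ∫⁻ w, ∏ t, f t w ∂chainKer k (List.finRange s) (a, v) = ∏ t, c t := by
  have hF : Measurable fun w => ∏ t, f t w := Finset.measurable_prod _ fun t _ => hf t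
  -- Induction over final segments `l` of the levels: factors of levels outside `l` stay frozen at
  -- `v`, while those in `l` have been replaced by their constants.
  have key : ∀ l : List (Fin s), l.Pairwise (· < ·) → (∀ u, u ∉ l → ∀ t ∈ l, u < t) → ∀ v,
      ∫⁻ w, ∏ t, f t w ∂chainKer k l (a, v) =
        (∏ u ∈ l.toFinsetᶜ, f u v) * ∏ u ∈ l.toFinset, c u := by
    intro l
    induction l with
    | nil => intro _ _ v; rw [lintegral_chainKer_nil k hF]; simp
    | cons t l ih =>
      intro hl hu v
      rw [List.pairwise_cons] at hl
      have htl : t ∉ l := fun h => lt_irrefl _ (hl.1 t h)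
      have htl' : t ∉ l.toFinset := by simpa using htl
      have hu' : ∀ u, u ∉ l → ∀ t ∈ l, u < t := fun u hul t' ht' => by
        by_cases h : u = t
        · exact h ▸ hl.1 t' ht'
        · exact hu u (by simp [h, hul]) t' (List.mem_cons_of_mem _ ht')
      -- After the first draw, `t` belongs to the frozen levels, and its factor is what remains to
      -- be integrated against `k t`.
      have hcompl : l.toFinsetᶜ = insert t (t :: l).toFinsetᶜ := by
        ext u
        by_cases h : u = t
        · simp [h, htl]
        · simp [h]
      rw [lintegral_chainKer_cons k _ _ hF]
      have : ∀ x, ∫⁻ w, ∏ t, f t w ∂chainKer k l (a, Function.update v t x) =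
          f t (Function.update v t x) *
            ((∏ u ∈ (t :: l).toFinsetᶜ, f u v) * ∏ u ∈ l.toFinset, c u) := fun x => by
        rw [ih hl.2 hu', hcompl, Finset.prod_insert (by simp), mul_assoc]
        congr 2
        refine Finset.prod_congr rfl fun u hul => hfu u t (hu u (by simpa using hul) t ?_) v x
        exact List.mem_cons_self
      simp only [this]
      rw [lintegral_mul_const _ (show Measurable fun x => f t (Function.update v t x) from
        (hf t).comp (measurable_update v)), hc, List.toFinset_cons,
        Finset.prod_insert htl']
      ring
  rw [key _ (List.pairwise_lt_finRange s) (fun u hu => absurd (List.mem_finRange u) hu)]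
  simp

/-- Averaging a chain over independent parameters, one for each link, averages its links. -/
theorem lmarginal_lintegral_chainKer {B : Type*} [MeasurableSpace B] {Θ : ι → Type*}
    [∀ i, MeasurableSpace (Θ i)] (π : ∀ i, Measure (Θ i)) [∀ i, SigmaFinite (π i)]
    (k : ∀ t, Kernel (((∀ i, Θ i) × B) × ∀ i, Z i) (Z t)) [∀ t, IsSFiniteKernel (k t)]
    (κ : ∀ t, Kernel (B × ∀ i, Z i) (Z t)) [∀ t, IsSFiniteKernel (κ t)] (b : B)
    {f : ∀ t, Θ t → ℝ≥0∞} (hf : ∀ t, Measurable (f t)) (m : ι → ℝ≥0∞)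
    (hk : ∀ t θ θ' v, θ t = θ' t → k t ((θ, b), v) = k t ((θ', b), v))
    (hκ : ∀ t θ v (G : Z t → ℝ≥0∞), Measurable G →
      ∫⁻ x, f t x * ∫⁻ z, G z ∂k t ((Function.update θ t x, b), v) ∂π t =
        m t * ∫⁻ z, G z ∂κ t (b, v))
    {F : (∀ i, Z i) → ℝ≥0∞} (hF : Measurable F) (l : List ι) (hl : l.Nodup)
    (θ : ∀ i, Θ i) (v : ∀ i, Z i) :
    (∫⋯∫⁻_l.toFinset, (fun θ => (l.map fun t => f t (θ t)).prod *
        ∫⁻ w, F w ∂chainKer k l ((θ, b), v)) ∂π) θ =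
      (l.map m).prod * ∫⁻ w, F w ∂chainKer κ l (b, v) := by
  have hmeas : ∀ (l : List ι), Measurable fun p : (∀ i, Θ i) × (∀ i, Z i) =>
      (l.map fun t => f t (p.1 t)).prod * ∫⁻ w, F w ∂chainKer k l ((p.1, b), p.2) := by
    intro l
    refine Measurable.mul ?_ (hF.lintegral_kernel.comp (by fun_prop))
    induction l with
    | nil => simp
    | cons t l ih =>
      simp only [List.map_cons, List.prod_cons]
      exact ((hf t).comp (by fun_prop)).mul ih
  induction l generalizing θ v with
  | nil => simp [lintegral_chainKer_nil _ hF]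
  | cons t l ih =>
    have hl' := List.nodup_cons.mp hl
    have htl : t ∉ l.toFinset := by simpa using hl'.1
    have hm1 : Measurable fun θ : ∀ i, Θ i => ((t :: l).map fun t => f t (θ t)).prod *
        ∫⁻ w, F w ∂chainKer k (t :: l) ((θ, b), v) :=
      (hmeas (t :: l)).comp measurable_prodMk_right
    rw [List.toFinset_cons, lmarginal_insert _ hm1 htl,
      List.map_cons, List.prod_cons, lintegral_chainKer_cons κ _ _ hF, mul_assoc,
      ← lintegral_const_mul _ (by
        exact hF.lintegral_kernel.comp (measurable_const.prodMk (measurable_update v))),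
      ← hκ t θ v _ (by
        exact (hF.lintegral_kernel.comp
          (measurable_const.prodMk (measurable_update v))).const_mul _)]
    refine lintegral_congr fun x => ?_
    -- Integrating the parameters of the later links leaves the parameter of `t` at `x`, so by `hk`
    -- the link `k t` is constant in them, and the two integrals can be exchanged.
    have hupd : ∀ y : (∀ i : l.toFinset, Θ i),
        (Function.updateFinset (Function.update θ t x) l.toFinset y) t = x := fun y => by
      rw [Function.updateFinset]
      simp [htl]
    rw [lmarginal]
    have e : ∀ y : (∀ i : l.toFinset, Θ i),
        ((f t (Function.updateFinset (Function.update θ t x) l.toFinset y t) ::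
            l.map fun u => f u (Function.updateFinset (Function.update θ t x) l.toFinset y u)).prod *
          ∫⁻ w, F w ∂chainKer k (t :: l)
            ((Function.updateFinset (Function.update θ t x) l.toFinset y, b), v)) =
        f t x * ∫⁻ z, (l.map fun u =>
            f u (Function.updateFinset (Function.update θ t x) l.toFinset y u)).prod *
          ∫⁻ w, F w ∂chainKer k l
            ((Function.updateFinset (Function.update θ t x) l.toFinset y, b),
              Function.update v t z) ∂k t ((Function.update θ t x, b), v) := fun y => by
      rw [lintegral_const_mul _ (by
        exact hF.lintegral_kernel.comp (measurable_const.prodMk (measurable_update v))),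
        List.prod_cons, lintegral_chainKer_cons k _ _ hF, hupd, mul_assoc]
      rw [hk t _ (Function.update θ t x) v (by rw [hupd, Function.update_self])]
    simp only [List.map_cons] at e ⊢
    rw [lintegral_congr e]
    have hm2 : Measurable (Function.uncurry fun (y : ∀ i : l.toFinset, Θ i) (z : Z t) =>
        (l.map fun u => f u (Function.updateFinset (Function.update θ t x) l.toFinset y u)).prod *
          ∫⁻ w, F w ∂chainKer k l
            ((Function.updateFinset (Function.update θ t x) l.toFinset y, b),
              Function.update v t z)) := by
      refine (hmeas l).comp (g := fun p => _) (f := fun p : (∀ i : l.toFinset, Θ i) × Z t =>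
        (Function.updateFinset (Function.update θ t x) l.toFinset p.1, Function.update v t p.2)) ?_
      exact (measurable_updateFinset.comp measurable_fst).prodMk
        ((measurable_update v).comp measurable_snd)
    rw [lintegral_const_mul _ hm2.lintegral_prod_right, lintegral_lintegral_swap hm2.aemeasurable]
    congr 1
    refine lintegral_congr fun z => ?_
    exact ih hl'.2 (Function.update θ t x) (Function.update v t z)

end ChainKernel

/-! ### Integrating out a Gaussian coefficient vector -/

theorem prod_gaussianPDF_zero {ι : Type*} [Fintype ι] {v : ℝ} (hv : 0 < v) (w : ι → ℝ) :
    ∏ i, gaussianPDF 0 v.toNNReal (w i) =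
      ENNReal.ofReal ((2 * Real.pi * v) ^ (-((Fintype.card ι : ℝ) / 2)) *
        Real.exp (-(w ⬝ᵥ w / 2 / v))) := by
  simp only [gaussianPDF_zero_toNNReal hv]
  rw [← ENNReal.ofReal_prod_of_nonneg (fun i _ => by positivity), Finset.prod_mul_distrib,
    Finset.prod_const, ← Real.exp_sum, Finset.card_univ, ← Real.rpow_natCast,
    ← Real.rpow_mul (by positivity)]
  congr 3
  · ring
  · simp only [dotProduct, Finset.sum_neg_distrib, Finset.sum_div, sq]

/-- A Gaussian with a Gaussian random mean is a convolution. This is how the uncertainty about `b`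
adds to the kriging variance. -/
theorem lintegral_gaussianReal_conv (m : ℝ) (v₁ v₂ : NNReal) {G : ℝ → ℝ≥0∞} (hG : Measurable G) :
    ∫⁻ z, ∫⁻ x, G x ∂gaussianReal (m + z) v₂ ∂gaussianReal 0 v₁ =
      ∫⁻ x, G x ∂gaussianReal m (v₁ + v₂) := by
  have h := gaussianReal_conv_gaussianReal (m₁ := 0) (m₂ := m) (v₁ := v₁) (v₂ := v₂)
  rw [zero_add] at h
  rw [← h, Measure.lintegral_conv hG]
  refine lintegral_congr fun z => ?_
  rw [← gaussianReal_map_const_add z, lintegral_map hG (by fun_prop)]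

theorem measurable_lintegral_gaussianReal {α : Type*} [MeasurableSpace α] {G : ℝ → ℝ≥0∞}
    (hG : Measurable G) {f : α → ℝ} (hf : Measurable f) {g : α → NNReal} (hg : Measurable g) :
    Measurable fun a => ∫⁻ x, G x ∂gaussianReal (f a) (g a) :=
  (Measure.measurable_lintegral hG).comp
    (measurable_gaussianReal.comp (hf.prodMk hg))

/-- Integrating a linear functional of a whitened Gaussian vector, in density form. -/
theorem lintegral_prod_gaussianPDF_mulVec {κ : Type*} [Fintype κ] [DecidableEq κ]
    {B : Matrix κ κ ℝ} (hB : IsUnit B.det) (b₀ a : κ → ℝ) {v c m : ℝ} (hv : 0 < v) (hc : 0 ≤ c)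
    {G : ℝ → ℝ≥0∞} (hG : Measurable G) :
    ENNReal.ofReal |B.det| * ∫⁻ b, (∏ j, gaussianPDF 0 v.toNNReal ((B *ᵥ (b - b₀)) j)) *
        ∫⁻ x, G x ∂gaussianReal (m + a ⬝ᵥ (b - b₀)) (v * c).toNNReal =
      ∫⁻ x, G x ∂gaussianReal m (v * (c + a ⬝ᵥ ((Bᵀ * B)⁻¹ *ᵥ a))).toNNReal := by
  have hBB : B⁻¹ * B = 1 := Matrix.nonsing_inv_mul _ hB
  have hv0 : v.toNNReal ≠ 0 := (Real.toNNReal_pos.mpr hv).ne'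
  have hpdf : Measurable (gaussianPDF 0 v.toNNReal) := measurable_gaussianPDF _ _
  -- In the whitened coordinate `w = B (b - b₀)` the functional `a ⬝ᵥ (b - b₀)` becomes `c' ⬝ᵥ w`,
  -- and the squared length of `c'` is the added variance.
  set c' : κ → ℝ := B⁻¹ᵀ *ᵥ a with hc'
  have hc'w : ∀ w, a ⬝ᵥ (B⁻¹ *ᵥ w) = c' ⬝ᵥ w := fun w => by
    rw [hc', Matrix.mulVec_transpose, Matrix.dotProduct_mulVec]
  have hc'c' : c' ⬝ᵥ c' = a ⬝ᵥ ((Bᵀ * B)⁻¹ *ᵥ a) := by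
    rw [← hc'w, hc', Matrix.mulVec_mulVec, Matrix.mul_inv_rev, Matrix.transpose_nonsing_inv]
  have hΦ : Measurable fun w : κ → ℝ => ∫⁻ x, G x ∂gaussianReal (m + c' ⬝ᵥ w) (v * c).toNNReal :=
    measurable_lintegral_gaussianReal hG (by fun_prop) measurable_const
  set Φ : (κ → ℝ) → ℝ≥0∞ := fun w => (∏ j, gaussianPDF 0 v.toNNReal (w j)) *
    ∫⁻ x, G x ∂gaussianReal (m + c' ⬝ᵥ w) (v * c).toNNReal with hΦ'
  have h1 : ∫⁻ b, (∏ j, gaussianPDF 0 v.toNNReal ((B *ᵥ (b - b₀)) j)) *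
        ∫⁻ x, G x ∂gaussianReal (m + a ⬝ᵥ (b - b₀)) (v * c).toNNReal = ∫⁻ b, Φ (B *ᵥ b) := by
    rw [← lintegral_sub_right_eq_self (fun b => Φ (B *ᵥ b)) b₀]
    refine lintegral_congr fun b => ?_
    rw [hΦ']
    dsimp only
    rw [← hc'w, Matrix.mulVec_mulVec, hBB, Matrix.one_mulVec]
  rw [h1, lintegral_comp_mulVec hB (by fun_prop), hΦ', ← lintegral_pi_gaussianReal hv0 hΦ]
  have h2 := lintegral_map (μ := Measure.pi fun _ : κ => gaussianReal 0 v.toNNReal)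
    (f := fun z => ∫⁻ x, G x ∂gaussianReal (m + z) (v * c).toNNReal)
    (g := fun w => c' ⬝ᵥ w)
    (measurable_lintegral_gaussianReal hG (by fun_prop) measurable_const) (by fun_prop)
  rw [← h2, map_dotProduct_pi_gaussianReal, lintegral_gaussianReal_conv m _ _ hG]
  congr 2
  have hcc : 0 ≤ c' ⬝ᵥ c' := by
    rw [dotProduct]
    exact Finset.sum_nonneg fun i _ => mul_self_nonneg _
  rw [← hc'c', ← Real.toNNReal_mul hv.le, ← Real.toNNReal_add (by positivity) (by positivity)]
  congr 1
  ring

/-! ### One level: completing the square and integrating out its parameters -/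

namespace Cokriging

variable {𝒳 : Type*} {s : ℕ} (C : Cokriging 𝒳 s)

/-- The factor of the reference prior at level `t`. -/
noncomputable def levelPrior (t : Fin s) : Measure ((C.Col t → ℝ) × ℝ) :=
  (volume : Measure (C.Col t → ℝ)).prod
    (((volume : Measure ℝ).restrict (Set.Ioi 0)).withDensity fun v => ENNReal.ofReal (1 / v))

instance (t : Fin s) : SigmaFinite (C.levelPrior t) := by
  unfold levelPrior; infer_instance

theorem refPrior_eq : C.refPrior = Measure.pi C.levelPrior := rfl

theorem lintegral_levelPrior (t : Fin s) {F : (C.Col t → ℝ) × ℝ → ℝ≥0∞} (hF : Measurable F) :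
    ∫⁻ θ, F θ ∂C.levelPrior t =
      ∫⁻ v in Set.Ioi (0 : ℝ), ENNReal.ofReal (1 / v) * ∫⁻ b, F (b, v) := by
  rw [levelPrior, lintegral_prod_symm _ hF.aemeasurable, lintegral_withDensity_eq_lintegral_mul]
  · rfl
  · fun_prop
  · exact hF.lintegral_prod_left'

variable [DecidableEq 𝒳]

/-- The density of `y_t` given `y_{t-1}`, at level parameters `θ = (b_t, σ_t²)`; here `A` whitens
`R_t`, that is, `R_t⁻¹ = Aᵀ A`. -/
noncomputable def levelDens (t : Fin s) (A : Matrix (C.X t) (C.X t) ℝ) (yp : C.PrevData t)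
    (y : C.X t → ℝ) (θ : (C.Col t → ℝ) × ℝ) : ℝ≥0∞ :=
  ENNReal.ofReal |A.det| *
    ∏ i, gaussianPDF 0 θ.2.toNNReal ((A *ᵥ (y - C.Xmat t yp *ᵥ θ.1)) i)

/-- The mean of `y_t(x₀)` given `y_{t-1}`, `y_t`, `w = y_{t-1}(x₀)` and the parameter `b`. -/
noncomputable def condMean (t : Fin s) (x₀ : 𝒳) (yp : C.PrevData t) (y : C.X t → ℝ)
    (w : Prev t → ℝ) (b : C.Col t → ℝ) : ℝ :=
  C.X0 t x₀ w ⬝ᵥ b + C.rvec t x₀ ⬝ᵥ ((C.R t)⁻¹ *ᵥ (y - C.Xmat t yp *ᵥ b))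

/-- The kriging variance at known parameters, relative to `σ_t²`. -/
noncomputable def condVar (t : Fin s) (x₀ : 𝒳) : ℝ :=
  C.r t x₀ x₀ - C.rvec t x₀ ⬝ᵥ ((C.R t)⁻¹ *ᵥ C.rvec t x₀)

variable {C}

theorem isSymm_R_inv {t : Fin s} (hR : (C.R t).PosDef) : ((C.R t)⁻¹)ᵀ = (C.R t)⁻¹ := by
  have := hR.inv.isHermitian
  rwa [Matrix.IsHermitian, Matrix.conjTranspose_eq_transpose_of_trivial] at this

/-- The kriging mean is affine in `b`, and moving the transpose across the symmetric `R_t⁻¹`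
identifies its slope. This is the origin of `a_t`. -/
theorem condMean_eq {t : Fin s} (hR : (C.R t).PosDef) (x₀ : 𝒳) (yp : C.PrevData t)
    (y : C.X t → ℝ) (w : Prev t → ℝ) (b : C.Col t → ℝ) :
    C.condMean t x₀ yp y w b =
      C.predMean t x₀ yp y w + C.avec t x₀ yp w ⬝ᵥ (b - C.bhat t yp y) := by
  have h : ∀ d, (((C.Xmat t yp)ᵀ * (C.R t)⁻¹) *ᵥ C.rvec t x₀) ⬝ᵥ d =
      C.rvec t x₀ ⬝ᵥ ((C.R t)⁻¹ *ᵥ (C.Xmat t yp *ᵥ d)) := fun d => by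
    rw [Matrix.mulVec_mulVec, dotProduct_comm, Matrix.dotProduct_mulVec,
      dotProduct_comm, ← Matrix.mulVec_transpose, Matrix.transpose_mul, Matrix.transpose_transpose,
      isSymm_R_inv hR]
  rw [condMean, predMean, avec, sub_dotProduct, h]
  simp only [Matrix.mulVec_sub, dotProduct_sub]
  ring

theorem gram_mulVec_bhat {t : Fin s} {yp : C.PrevData t} (hg : IsUnit (C.gram t yp).det)
    (y : C.X t → ℝ) :
    C.gram t yp *ᵥ C.bhat t yp y = ((C.Xmat t yp)ᵀ * (C.R t)⁻¹) *ᵥ y := by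
  rw [bhat, Matrix.mulVec_mulVec, Matrix.mul_assoc, ← Matrix.mul_assoc (C.gram t yp),
    Matrix.mul_nonsing_inv _ hg, Matrix.one_mul]

/-- The generalized sum of squares is a quadratic function with minimizer `b̂_t`. -/
theorem gss_eq {t : Fin s} (hR : (C.R t).PosDef) {yp : C.PrevData t}
    (hg : IsUnit (C.gram t yp).det) (y : C.X t → ℝ) (b : C.Col t → ℝ) :
    C.gss t yp y b = C.gss t yp y (C.bhat t yp y) +
      (b - C.bhat t yp y) ⬝ᵥ (C.gram t yp *ᵥ (b - C.bhat t yp y)) := by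
  set d := b - C.bhat t yp y with hd
  set e := y - C.Xmat t yp *ᵥ C.bhat t yp y with he
  have hb : y - C.Xmat t yp *ᵥ b = e - C.Xmat t yp *ᵥ d := by
    rw [he, hd, Matrix.mulVec_sub]
    abel
  -- The normal equations; they remove the cross terms of the quadratic form.
  have hzero : ((C.Xmat t yp)ᵀ * (C.R t)⁻¹) *ᵥ e = 0 := by
    rw [he, Matrix.mulVec_sub, ← gram_mulVec_bhat hg, Matrix.mulVec_mulVec, ← gram, sub_self]
  have hcross : (C.Xmat t yp *ᵥ d) ⬝ᵥ ((C.R t)⁻¹ *ᵥ e) = 0 := by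
    rw [dotProduct_comm, Matrix.dotProduct_mulVec, ← Matrix.mulVec_transpose,
      Matrix.mulVec_mulVec, hzero, zero_dotProduct]
  have hcross' : e ⬝ᵥ ((C.R t)⁻¹ *ᵥ (C.Xmat t yp *ᵥ d)) = 0 := by
    rw [Matrix.dotProduct_mulVec, ← Matrix.mulVec_transpose, isSymm_R_inv hR, dotProduct_comm,
      hcross]
  have hquad : (C.Xmat t yp *ᵥ d) ⬝ᵥ ((C.R t)⁻¹ *ᵥ (C.Xmat t yp *ᵥ d)) =
      d ⬝ᵥ (C.gram t yp *ᵥ d) := by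
    rw [dotProduct_comm, Matrix.dotProduct_mulVec, ← Matrix.mulVec_transpose,
      Matrix.mulVec_mulVec, Matrix.mulVec_mulVec, gram, Matrix.mul_assoc, dotProduct_comm]
  rw [gss, gss, hb, ← he, Matrix.mulVec_sub (C.R t)⁻¹, sub_dotProduct, dotProduct_sub, dotProduct_sub,
    hcross, hcross', hquad]
  ring

theorem posSemidef_gram {t : Fin s} (hR : (C.R t).PosDef) (yp : C.PrevData t) :
    (C.gram t yp).PosSemidef := by
  have := hR.inv.posSemidef.conjTranspose_mul_mul_same (C.Xmat t yp)
  rwa [Matrix.conjTranspose_eq_transpose_of_trivial] at this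

theorem posDef_gram {t : Fin s} (hR : (C.R t).PosDef) {yp : C.PrevData t}
    (hg : IsUnit (C.gram t yp).det) : (C.gram t yp).PosDef :=
  (posSemidef_gram hR yp).posDef_iff_det_ne_zero.mpr hg.ne_zero

/-- `b̂_t` is the unique minimizer of the generalized sum of squares. -/
theorem gss_bhat_lt {t : Fin s} (hR : (C.R t).PosDef) {yp : C.PrevData t}
    (hg : IsUnit (C.gram t yp).det) (y : C.X t → ℝ) {b : C.Col t → ℝ}
    (hb : b ≠ C.bhat t yp y) : C.gss t yp y (C.bhat t yp y) < C.gss t yp y b := by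
  rw [gss_eq hR hg y b]
  have := (posDef_gram hR hg).dotProduct_mulVec_pos (sub_ne_zero.mpr hb)
  rw [star_trivial] at this
  linarith

theorem gss_eq_dotProduct {t : Fin s} {A : Matrix (C.X t) (C.X t) ℝ}
    (hRA : (C.R t)⁻¹ = Aᵀ * A) (yp : C.PrevData t) (y : C.X t → ℝ) (b : C.Col t → ℝ) :
    C.gss t yp y b =
      (A *ᵥ (y - C.Xmat t yp *ᵥ b)) ⬝ᵥ (A *ᵥ (y - C.Xmat t yp *ᵥ b)) := by
  rw [gss, hRA, ← Matrix.mulVec_mulVec, Matrix.dotProduct_mulVec, Matrix.vecMul_transpose]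

theorem measurable_levelDens (t : Fin s) (A : Matrix (C.X t) (C.X t) ℝ) :
    Measurable fun p : (C.PrevData t × (C.X t → ℝ)) × ((C.Col t → ℝ) × ℝ) =>
      C.levelDens t A p.1.1 p.1.2 p.2 := by
  unfold levelDens
  refine Measurable.const_mul (Finset.measurable_prod _ fun i _ => ?_) _
  refine measurable_uncurry_gaussianPDF.comp
    (f := fun p : (C.PrevData t × (C.X t → ℝ)) × ((C.Col t → ℝ) × ℝ) =>
      ((0 : ℝ), p.2.2.toNNReal, (A *ᵥ (p.1.2 - C.Xmat t p.1.1 *ᵥ p.2.1)) i)) ?_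
  refine measurable_const.prodMk ((by fun_prop : Measurable _).prodMk ?_)
  simp only [Matrix.mulVec, dotProduct, Pi.sub_apply, Xmat, Matrix.of_apply,
    Fintype.sum_sum_type, Sum.elim_inl, Sum.elim_inr]
  fun_prop

theorem measurable_condMean (t : Fin s) (x₀ : 𝒳) :
    Measurable fun p : (C.PrevData t × (C.X t → ℝ)) × (Prev t → ℝ) × (C.Col t → ℝ) =>
      C.condMean t x₀ p.1.1 p.1.2 p.2.1 p.2.2 := by
  simp only [condMean, Matrix.mulVec, dotProduct, Pi.sub_apply, Xmat, X0, Matrix.of_apply,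
    Fintype.sum_sum_type, Sum.elim_inl, Sum.elim_inr]
  fun_prop

theorem measurable_levelDens_mul {t : Fin s} {G : ℝ → ℝ≥0∞} (hG : Measurable G)
    (A : Matrix (C.X t) (C.X t) ℝ) (x₀ : 𝒳) (yp : C.PrevData t) (y : C.X t → ℝ)
    (w : Prev t → ℝ) :
    Measurable fun θ : (C.Col t → ℝ) × ℝ => C.levelDens t A yp y θ *
      ∫⁻ x, G x ∂gaussianReal (C.condMean t x₀ yp y w θ.1) (θ.2 * C.condVar t x₀).toNNReal := by
  have h1 : Measurable fun θ : (C.Col t → ℝ) × ℝ => C.levelDens t A yp y θ :=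
    (measurable_levelDens t A).comp
      (f := fun θ : (C.Col t → ℝ) × ℝ => ((yp, y), θ)) (by fun_prop)
  have h2 : Measurable fun θ : (C.Col t → ℝ) × ℝ => C.condMean t x₀ yp y w θ.1 :=
    (measurable_condMean t x₀).comp (f := fun θ : (C.Col t → ℝ) × ℝ => ((yp, y), (w, θ.1)))
      (by fun_prop)
  exact h1.mul (measurable_lintegral_gaussianReal hG h2 (by fun_prop))

/-- Completing the square in the density of a level. -/
theorem levelDens_eq {t : Fin s} (hR : (C.R t).PosDef) {A : Matrix (C.X t) (C.X t) ℝ}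
    (hRA : (C.R t)⁻¹ = Aᵀ * A) {yp : C.PrevData t} (hg : IsUnit (C.gram t yp).det)
    {B : Matrix (C.Col t) (C.Col t) ℝ} (hB : C.gram t yp = Bᵀ * B) (y : C.X t → ℝ)
    (b : C.Col t → ℝ) {v : ℝ} (hv : 0 < v) :
    C.levelDens t A yp y (b, v) =
      ENNReal.ofReal (|A.det| * (2 * Real.pi * v) ^ (-(((C.n t : ℝ) - C.q t) / 2)) *
        Real.exp (-(C.gss t yp y (C.bhat t yp y) / 2 / v))) *
        ∏ j, gaussianPDF 0 v.toNNReal ((B *ᵥ (b - C.bhat t yp y)) j) := by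
  have hq : (B *ᵥ (b - C.bhat t yp y)) ⬝ᵥ (B *ᵥ (b - C.bhat t yp y)) =
      (b - C.bhat t yp y) ⬝ᵥ (C.gram t yp *ᵥ (b - C.bhat t yp y)) := by
    rw [hB, ← Matrix.mulVec_mulVec, Matrix.dotProduct_mulVec _ Bᵀ, Matrix.vecMul_transpose]
  rw [levelDens, prod_gaussianPDF_zero hv, prod_gaussianPDF_zero hv, hq,
    ← gss_eq_dotProduct hRA, gss_eq hR hg y b, ← ENNReal.ofReal_mul (abs_nonneg _),
    ← ENNReal.ofReal_mul (by positivity)]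
  congr 1
  -- Of the `n_t` Gaussian normalizations, `q_t` belong to the density of `b`; the remaining `n_t -
  -- q_t` become the degrees of freedom.
  have e1 : (2 * Real.pi * v) ^ (-((Fintype.card (C.X t) : ℝ) / 2)) =
      (2 * Real.pi * v) ^ (-(((C.n t : ℝ) - C.q t) / 2)) *
        (2 * Real.pi * v) ^ (-((Fintype.card (C.Col t) : ℝ) / 2)) := by
    rw [← Real.rpow_add (by positivity), Fintype.card_coe]
    congr 1
    simp only [n, q]
    ring
  rw [e1, add_div, add_div, neg_add, Real.exp_add]
  ring

theorem cstar_nonneg {t : Fin s} (hR : (C.R t).PosDef) {x₀ : 𝒳} (hc : 0 ≤ C.condVar t x₀)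
    (yp : C.PrevData t) (w : Prev t → ℝ) : 0 ≤ C.cstar t x₀ yp w := by
  have := (posSemidef_gram hR yp).inv.dotProduct_mulVec_nonneg (C.avec t x₀ yp w)
  rw [star_trivial] at this
  exact add_nonneg hc this

/-- Integrating out `β`, `γ` and `σ²` at one level. -/
theorem exists_lintegral_levelDens {t : Fin s} (hR : (C.R t).PosDef) (hq : C.q t < C.n t)
    {x₀ : 𝒳} (hc : 0 ≤ C.condVar t x₀) {A : Matrix (C.X t) (C.X t) ℝ} (hA : IsUnit A.det)
    (hRA : (C.R t)⁻¹ = Aᵀ * A) {yp : C.PrevData t} (hg : IsUnit (C.gram t yp).det)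
    {y : C.X t → ℝ} (hS : 0 < C.sigmaHatSq t yp y) :
    ∃ m : ℝ≥0∞, m ≠ 0 ∧ m ≠ ∞ ∧ ∀ (w : Prev t → ℝ) (G : ℝ → ℝ≥0∞), Measurable G →
      ∫⁻ θ, C.levelDens t A yp y θ *
        ∫⁻ x, G x ∂gaussianReal (C.condMean t x₀ yp y w θ.1) (θ.2 * C.condVar t x₀).toNNReal
        ∂C.levelPrior t = m * ∫⁻ x, G x ∂C.levelLaw t x₀ yp y w := by
  obtain ⟨B, hBu, hB⟩ := (posDef_gram hR hg).exists_isUnit_det_eq_transpose_mul_self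
  set ν : ℝ := (C.n t : ℝ) - C.q t with hν'
  have hν : 0 < ν := by
    have : (C.q t : ℝ) < C.n t := by exact_mod_cast hq
    linarith
  set S := C.gss t yp y (C.bhat t yp y) with hS'
  have hS0 : 0 < S := by
    have h : 0 < S / ν := hS
    rwa [div_pos_iff_of_pos_right hν] at h
  have hdB : 0 < |B.det| := abs_pos.mpr hBu.ne_zero
  have hdA : 0 < |A.det| := abs_pos.mpr hA.ne_zero
  have hΓ := Real.Gamma_pos_of_pos (s := ν / 2) (by positivity)
  -- `|A.det|` normalizes the density of the data, `|B.det|⁻¹` is the Jacobian from whitening `b`,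
  -- and the power of `2π` is left over from completing the square.
  set K : ℝ := |A.det| * |B.det|⁻¹ * (2 * Real.pi) ^ (-(ν / 2)) with hK
  have hK0 : 0 < K := by positivity
  refine ⟨ENNReal.ofReal K * ENNReal.ofReal (Real.Gamma (ν / 2) * (S / 2) ^ (-(ν / 2))),
    mul_ne_zero (by simpa using hK0) (by rw [ENNReal.ofReal_ne_zero_iff]; positivity),
    by finiteness, fun w G hG => ?_⟩
  have hm : Measurable fun θ : (C.Col t → ℝ) × ℝ => C.levelDens t A yp y θ *
      ∫⁻ x, G x ∂gaussianReal (C.condMean t x₀ yp y w θ.1) (θ.2 * C.condVar t x₀).toNNReal := by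
    exact measurable_levelDens_mul hG A x₀ yp y w
  rw [lintegral_levelPrior _ _ hm]
  have hmix := lintegral_gaussianReal_mixture_affine (μ := C.predMean t x₀ yp y w) hν hS0
    (cstar_nonneg hR hc yp w) hG
  rw [levelLaw, sigmaHatSq, ← hS', ← hν', mul_assoc, ← hmix,
    ← lintegral_const_mul' _ _ ENNReal.ofReal_ne_top]
  refine setLIntegral_congr_fun measurableSet_Ioi fun v hv => ?_
  have hv0 : 0 < v := hv
  simp only [levelDens_eq hR hRA hg hB y _ hv0, condMean_eq hR, mul_assoc]
  rw [lintegral_const_mul' _ _ ENNReal.ofReal_ne_top]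
  have hint := lintegral_prod_gaussianPDF_mulVec hBu (C.bhat t yp y) (C.avec t x₀ yp w)
    (m := C.predMean t x₀ yp y w) hv0 hc hG
  rw [← hB] at hint
  have hcs : C.cstar t x₀ yp w = C.condVar t x₀ +
    C.avec t x₀ yp w ⬝ᵥ ((C.gram t yp)⁻¹ *ᵥ C.avec t x₀ yp w) := rfl
  rw [hcs, ← hint]
  simp only [← mul_assoc]
  rw [← ENNReal.ofReal_mul (by positivity), ← ENNReal.ofReal_mul hK0.le,
    ← ENNReal.ofReal_mul (by positivity)]
  congr 2
  -- The prior factor `1 / v` turns `v ^ (-ν / 2)` into `v ^ (-ν / 2 - 1)`, the inverse gamma weight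
  -- of shape `ν / 2`.
  rw [hK, ← hν', ← hS', Real.mul_rpow (by positivity) hv0.le, Real.rpow_sub_one hv0.ne']
  field_simp

end Cokriging

/-! ### Gaussian regression -/

section Regression

variable {Ω ι : Type*} [MeasurableSpace Ω] {P : Measure Ω} [Fintype ι]

/-- Covariances of linear combinations. -/
theorem covariance_dotProduct_right [IsProbabilityMeasure P] {E : ι → Ω → ℝ}
    (hE : ∀ i, MemLp (E i) 2 P) {Z : Ω → ℝ} (hZ : MemLp Z 2 P) (b : ι → ℝ) :
    cov[Z, fun ω => ∑ j, b j * E j ω; P] = b ⬝ᵥ fun j => cov[Z, E j; P] := by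
  rw [covariance_fun_sum_right (fun j => (hE j).const_mul (b j)) hZ]
  simp only [covariance_const_mul_right, dotProduct]

theorem covariance_dotProduct_left [IsProbabilityMeasure P] {E : ι → Ω → ℝ}
    (hE : ∀ i, MemLp (E i) 2 P) {Z : Ω → ℝ} (hZ : MemLp Z 2 P) (b : ι → ℝ) :
    cov[fun ω => ∑ j, b j * E j ω, Z; P] = b ⬝ᵥ fun j => cov[E j, Z; P] := by
  rw [covariance_comm, covariance_dotProduct_right hE hZ]
  simp only [covariance_comm]

/-- Regression of a centered Gaussian variable `E₀` on a centered nondegenerate Gaussian vector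
`E`, in density form. -/
theorem HasGaussianLaw.lintegral_regression [DecidableEq ι] {E : ι → Ω → ℝ} {E₀ : Ω → ℝ}
    (hG : HasGaussianLaw (fun ω => ((fun i => E i ω), E₀ ω)) P) (hE : ∀ i, ∫ ω, E i ω ∂P = 0)
    (hE₀ : ∫ ω, E₀ ω ∂P = 0) {R A : Matrix ι ι ℝ} {r : ι → ℝ} {r₀ v : ℝ} (hv : 0 < v)
    (hR : R.PosDef) (hA : IsUnit A.det) (hRA : R⁻¹ = Aᵀ * A)
    (hcov : ∀ i j, cov[E i, E j; P] = v * R i j) (hcov₀ : ∀ i, cov[E i, E₀; P] = v * r i)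
    (hvar : cov[E₀, E₀; P] = v * r₀) :
    0 ≤ r₀ - r ⬝ᵥ (R⁻¹ *ᵥ r) ∧ ∀ F : (ι → ℝ) × ℝ → ℝ≥0∞, Measurable F →
      ∫⁻ ω, F ((fun i => E i ω), E₀ ω) ∂P =
        ∫⁻ e, ENNReal.ofReal |A.det| * (∏ i, gaussianPDF 0 v.toNNReal ((A *ᵥ e) i)) *
          ∫⁻ x, F (e, x)
            ∂gaussianReal (r ⬝ᵥ (R⁻¹ *ᵥ e)) (v * (r₀ - r ⬝ᵥ (R⁻¹ *ᵥ r))).toNNReal := by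
  have hPr : IsProbabilityMeasure P := hG.isProbabilityMeasure
  have hEm : ∀ i, MemLp (E i) 2 P := fun i => (hG.fst.eval i).memLp_two
  have hE₀m : MemLp E₀ 2 P := hG.snd.memLp_two
  have hRu : IsUnit R.det := hR.det_pos.ne'.isUnit
  set β : ι → ℝ := R⁻¹ *ᵥ r with hβ
  have hRβ : R *ᵥ β = r := by
    rw [hβ, Matrix.mulVec_mulVec, Matrix.mul_nonsing_inv _ hRu, Matrix.one_mulVec]
  have hsymm : (R⁻¹)ᵀ = R⁻¹ := by rw [hRA, Matrix.transpose_mul, Matrix.transpose_transpose]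
  have hβe : ∀ e, r ⬝ᵥ (R⁻¹ *ᵥ e) = β ⬝ᵥ e := fun e => by
    rw [Matrix.dotProduct_mulVec, ← Matrix.mulVec_transpose, hsymm]
  -- A one-sided inverse of a square matrix is two-sided, so `R * Aᵀ * A = 1` can be commuted; the
  -- whitened vector `A E` then has covariance `v • 1`.
  have hARA : A * R * Aᵀ = 1 := by
    have h1 : R * (Aᵀ * A) = 1 := by rw [← hRA, Matrix.mul_nonsing_inv _ hRu]
    have h2 : R * Aᵀ * A = 1 := by rw [Matrix.mul_assoc, h1]
    have h3 := mul_eq_one_comm.mp h2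
    rw [Matrix.mul_assoc, h3]
  -- `W` is the whitened vector, `B` the best linear predictor of `E₀` from `E`, and `U` its error,
  -- which is uncorrelated with each `E i` and hence with each `W i`.
  set W : ι → Ω → ℝ := fun i ω => ∑ j, A i j * E j ω with hW
  set B : Ω → ℝ := fun ω => ∑ j, β j * E j ω with hB
  set U : Ω → ℝ := fun ω => E₀ ω - B ω with hU
  have hWm : ∀ i, MemLp (W i) 2 P := fun i =>
    memLp_finsetSum _ fun j _ => (hEm j).const_mul (A i j)
  have hBm : MemLp B 2 P := memLp_finsetSum _ fun j _ => (hEm j).const_mul (β j)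
  have hUm : MemLp U 2 P := hE₀m.sub hBm
  have hEB : ∀ i, cov[E i, B; P] = v * r i := fun i => by
    rw [hB, covariance_dotProduct_right hEm (hEm i), ← hRβ]
    simp only [hcov, Matrix.mulVec, dotProduct, Finset.mul_sum]
    exact Finset.sum_congr rfl fun j _ => by ring
  have hEU : ∀ i, cov[E i, U; P] = 0 := fun i => by
    rw [hU, covariance_fun_sub_right (hEm i) hE₀m hBm, hEB, hcov₀, sub_self]
  have hWU : ∀ i, cov[W i, U; P] = 0 := fun i => by
    rw [hW, covariance_dotProduct_left hEm hUm]
    simp [hEU, dotProduct]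
  have hWW : ∀ i k, cov[W i, W k; P] = v * (1 : Matrix ι ι ℝ) i k := fun i k => by
    rw [hW, covariance_dotProduct_left hEm (hWm k), ← hARA]
    have : ∀ j, cov[E j, W k; P] = v * (R * Aᵀ) j k := fun j => by
      rw [hW, covariance_dotProduct_right hEm (hEm j), Matrix.mul_apply]
      simp only [hcov, dotProduct, Finset.mul_sum, Matrix.transpose_apply]
      exact Finset.sum_congr rfl fun j _ => by ring
    rw [Matrix.mul_assoc, Matrix.mul_apply]
    simp only [this, dotProduct, Finset.mul_sum]
    exact Finset.sum_congr rfl fun j _ => by ring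
  have hUU : Var[U; P] = v * (r₀ - r ⬝ᵥ β) := by
    rw [← covariance_self hUm.aemeasurable]
    have hBU : cov[B, U; P] = 0 := by
      rw [hB, covariance_dotProduct_left hEm hUm]
      simp [hEU, dotProduct]
    have hE₀B : cov[E₀, B; P] = v * (r ⬝ᵥ β) := by
      rw [hB, covariance_dotProduct_right hEm hE₀m]
      simp only [covariance_comm (E₀), hcov₀, dotProduct, Finset.mul_sum]
      exact Finset.sum_congr rfl fun j _ => by ring
    conv_lhs => rw [hU]
    rw [covariance_fun_sub_left hE₀m hBm hUm, hBU, hU, covariance_fun_sub_right hE₀m hE₀m hBm,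
      hvar, hE₀B]
    ring
  have hc : 0 ≤ r₀ - r ⬝ᵥ β := by
    have := variance_nonneg U P
    rw [hUU] at this
    exact nonneg_of_mul_nonneg_right this hv
  refine ⟨hc, fun F hF => ?_⟩
  have hEint : ∀ i, Integrable (E i) P := fun i => (hEm i).integrable one_le_two
  have hWmean : ∀ i, ∫ ω, W i ω ∂P = 0 := fun i => by
    rw [hW, integral_finsetSum _ fun j _ => (hEint j).const_mul _]
    simp [integral_const_mul, hE]
  have hUmean : ∫ ω, U ω ∂P = 0 := by
    rw [hU, integral_sub (hE₀m.integrable one_le_two) (hBm.integrable one_le_two), hE₀, hB,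
      integral_finsetSum _ fun j _ => (hEint j).const_mul _]
    simp [integral_const_mul, hE]
  -- joint normality of the residual and the whitened vector
  let L : ((ι → ℝ) × ℝ) →ₗ[ℝ] (ι → ℝ) × (Unit → ℝ) :=
    { toFun := fun p => (A *ᵥ p.1, fun _ => p.2 - β ⬝ᵥ p.1)
      map_add' := fun p q => by
        ext <;> simp [Matrix.mulVec_add]; ring
      map_smul' := fun c p => by
        ext <;> simp [Matrix.mulVec_smul]; ring }
  have hWUG : HasGaussianLaw (fun ω => ((fun i => W i ω), fun _ : Unit => U ω)) P :=
    hG.map_fun L.toContinuousLinearMap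
  have hWi : iIndepFun W P := hWUG.fst.iIndepFun_of_covariance_eq_zero fun i j hij => by
    rw [hWW, Matrix.one_apply_ne hij, mul_zero]
  have hWlaw : P.map (fun ω i => W i ω) = Measure.pi fun _ => gaussianReal 0 v.toNNReal := by
    rw [hWi.map_fun_eq_pi_map fun i => (hWm i).aemeasurable]
    congr 1
    ext1 i
    rw [(hWUG.fst.eval i).map_eq_gaussianReal, hWmean,
      ← covariance_self (hWm i).aemeasurable, hWW, Matrix.one_apply_eq, mul_one]
  have hUlaw : P.map U = gaussianReal 0 (v * (r₀ - r ⬝ᵥ β)).toNNReal := by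
    rw [(hWUG.snd.eval ()).map_eq_gaussianReal, hUmean, hUU]
  -- Jointly Gaussian and uncorrelated implies independent; `U` is viewed as a vector indexed by
  -- `Unit` to fit the vector criterion.
  have hind : IndepFun (fun ω i => W i ω) U P :=
    (hWUG.indepFun_of_covariance_eval (Y := fun _ : Unit => U) fun i _ => hWU i).comp
      measurable_id (measurable_pi_apply ())
  have hWae : AEMeasurable (fun ω i => W i ω) P := hWUG.fst.aemeasurable
  have hlaw := hind.map_prod_eq_prod_map_map hWae hUm.aemeasurable
  rw [hWlaw, hUlaw] at hlaw
  have hAinv : A⁻¹ * A = 1 := Matrix.nonsing_inv_mul _ hA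
  -- Inverts the passage to `(W, U)`: `E = A⁻¹ W` and `E₀ = β ⬝ᵥ E + U`.
  set F' : (ι → ℝ) × ℝ → ℝ≥0∞ := fun p => F (A⁻¹ *ᵥ p.1, β ⬝ᵥ (A⁻¹ *ᵥ p.1) + p.2) with hF'
  have hF'm : Measurable F' := hF.comp (by
    simp only [Matrix.mulVec, dotProduct]
    fun_prop)
  have h1 : ∫⁻ ω, F ((fun i => E i ω), E₀ ω) ∂P = ∫⁻ ω, F' ((fun i => W i ω), U ω) ∂P := by
    refine lintegral_congr fun ω => ?_
    have : (fun i => W i ω) = A *ᵥ fun i => E i ω := rfl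
    rw [hF']
    dsimp only
    rw [this, Matrix.mulVec_mulVec, hAinv, Matrix.one_mulVec]
    congr 2
    rw [hU, hB]
    simp only [dotProduct]
    ring
  rw [h1, ← lintegral_map' hF'm.aemeasurable (hWae.prodMk hUm.aemeasurable), hlaw,
    lintegral_prod _ hF'm.aemeasurable,
    lintegral_pi_gaussianReal (Real.toNNReal_pos.mpr hv).ne' hF'm.lintegral_prod_right']
  rw [← lintegral_comp_mulVec hA, ← lintegral_const_mul' _ _ ENNReal.ofReal_ne_top]
  · refine lintegral_congr fun e => ?_
    rw [mul_assoc]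
    congr 2
    rw [hF', hβe e]
    dsimp only
    rw [Matrix.mulVec_mulVec, hAinv, Matrix.one_mulVec,
      ← lintegral_map (f := fun x => F (e, x)) (hF.comp measurable_prodMk_left) (by fun_prop),
      gaussianReal_map_const_add, zero_add]
  · refine Measurable.mul ?_ hF'm.lintegral_prod_right'
    exact Finset.measurable_prod _ fun i _ =>
      (measurable_gaussianPDF 0 _).comp (measurable_pi_apply i)

end Regression

/-! ### Residuals, and the law of the outputs at known parameters -/

namespace Cokriging

variable {𝒳 : Type*} {s : ℕ} (C : Cokriging 𝒳 s)

/-- The residual `y_t - X_t b_t`. -/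
def resid (t : Fin s) (b : C.Col t → ℝ) (y : C.Data) : C.X t → ℝ :=
  y t - C.Xmat t (fun u => y u.1) *ᵥ b

/-- The residual `v_t - X_t(x₀)ᵀ b_t` at the new input. -/
def resid₀ (x₀ : 𝒳) (t : Fin s) (b : C.Col t → ℝ) (v : Fin s → ℝ) : ℝ :=
  v t - C.X0 t x₀ (fun u => v u.1) ⬝ᵥ b

/-- The map from the outputs to the centered discrepancies. -/
def residuals (x₀ : 𝒳) (θ : C.Param) (p : C.Data × (Fin s → ℝ)) (t : Fin s) :
    (C.X t → ℝ) × ℝ :=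
  (C.resid t (θ t).1 p.1, C.resid₀ x₀ t (θ t).1 p.2)

theorem resid_apply (t : Fin s) (b : C.Col t → ℝ) (y : C.Data) (x : C.X t) :
    C.resid t b y x = y t x - (∑ j, C.h t x j * b (Sum.inl j) +
      ∑ u : Prev t, y u.1 ⟨x, C.nested t u x.2⟩ * b (Sum.inr u)) := by
  simp [resid, Xmat, Matrix.mulVec, dotProduct]

theorem resid₀_eq (x₀ : 𝒳) (t : Fin s) (b : C.Col t → ℝ) (v : Fin s → ℝ) :
    C.resid₀ x₀ t b v = v t - (∑ j, C.h t x₀ j * b (Sum.inl j) +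
      ∑ u : Prev t, v u.1 * b (Sum.inr u)) := by
  simp [resid₀, X0, dotProduct]

theorem measurable_resid (t : Fin s) :
    Measurable fun p : (C.Col t → ℝ) × C.Data => C.resid t p.1 p.2 := by
  refine measurable_pi_lambda _ fun x => ?_
  simp only [resid_apply]
  fun_prop

theorem measurable_resid₀ (x₀ : 𝒳) (t : Fin s) :
    Measurable fun p : (C.Col t → ℝ) × (Fin s → ℝ) => C.resid₀ x₀ t p.1 p.2 := by
  simp only [resid₀_eq]
  fun_prop

theorem measurable_residuals (x₀ : 𝒳) (θ : C.Param) : Measurable (C.residuals x₀ θ) := by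
  refine measurable_pi_lambda _ fun t => ?_
  exact ((C.measurable_resid t).comp (f := fun p : C.Data × (Fin s → ℝ) => ((θ t).1, p.1))
      (by fun_prop)).prodMk
    ((C.measurable_resid₀ x₀ t).comp (f := fun p : C.Data × (Fin s → ℝ) => ((θ t).1, p.2))
      (by fun_prop))

theorem Prev.lt {t : Fin s} (u : Prev t) : u.1 < t := by
  have := u.2
  rw [Fin.lt_def]
  omega

/-- The outputs are recovered recursively: once the preceding level is known, a residual determines
the output of its own level. -/
theorem injective_residuals (x₀ : 𝒳) (θ : C.Param) : Function.Injective (C.residuals x₀ θ) := by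
  intro p q hpq
  have key : ∀ k : ℕ, ∀ t : Fin s, (t : ℕ) = k → p.1 t = q.1 t ∧ p.2 t = q.2 t := by
    intro k
    induction k using Nat.strong_induction_on with
    | _ k ih =>
      intro t ht
      have hprev : ∀ u : Prev t, p.1 u.1 = q.1 u.1 ∧ p.2 u.1 = q.2 u.1 := fun u =>
        ih u.1 (by have := u.2; omega) u.1 rfl
      have h := congrFun hpq t
      simp only [residuals, Prod.mk.injEq] at h
      constructor
      · ext x
        have h1 := congrFun h.1 x
        rw [resid_apply, resid_apply] at h1
        simp only [fun u => (hprev u).1] at h1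
        linarith
      · have h2 := h.2
        rw [resid₀_eq, resid₀_eq] at h2
        simp only [fun u => (hprev u).2] at h2
        linarith
  exact Prod.ext (funext fun t => (key t t rfl).1) (funext fun t => (key t t rfl).2)

theorem resid_update (b : ∀ t, C.Col t → ℝ) {u t : Fin s} (h : u < t) (y : C.Data)
    (x : C.X t → ℝ) : C.resid u (b u) (Function.update y t x) = C.resid u (b u) y := by
  ext z
  have h2 : ∀ u' : Prev u, u'.1 ≠ t := fun u' => (lt_trans (Prev.lt u') h).ne
  simp [resid_apply, Function.update_of_ne h.ne, h2]

/-- The newest output enters its residual through a translation by a function of the preceding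
level; this is the source of volume preservation. -/
theorem resid_update_self {t : Fin s} (b : C.Col t → ℝ) (y : C.Data) (x : C.X t → ℝ) :
    C.resid t b (Function.update y t x) = x - C.Xmat t (fun u => y u.1) *ᵥ b := by
  have h2 : (fun u : Prev t => Function.update y t x u.1) = fun u : Prev t => y u.1 :=
    funext fun u => Function.update_of_ne (Prev.lt u).ne _ _
  rw [resid, h2, Function.update_self]

theorem resid₀_update (x₀ : 𝒳) (b : ∀ t, C.Col t → ℝ) {u t : Fin s} (h : u < t)
    (v : Fin s → ℝ) (x : ℝ) :
    C.resid₀ x₀ u (b u) (Function.update v t x) = C.resid₀ x₀ u (b u) v := by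
  have h2 : ∀ u' : Prev u, u'.1 ≠ t := fun u' => (lt_trans (Prev.lt u') h).ne
  simp [resid₀_eq, Function.update_of_ne h.ne, h2]

theorem resid₀_update_self (x₀ : 𝒳) {t : Fin s} (b : C.Col t → ℝ) (v : Fin s → ℝ) (x : ℝ) :
    C.resid₀ x₀ t b (Function.update v t x) = x - C.X0 t x₀ (fun u => v u.1) ⬝ᵥ b := by
  have h2 : (fun u : Prev t => Function.update v t x u.1) = fun u : Prev t => v u.1 :=
    funext fun u => Function.update_of_ne (Prev.lt u).ne _ _
  rw [resid₀, h2, Function.update_self]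

/-- Passing from the data to the residuals preserves volume. -/
theorem lintegral_prod_resid (b : ∀ t, C.Col t → ℝ) {f : ∀ t, (C.X t → ℝ) → ℝ≥0∞}
    (hf : ∀ t, Measurable (f t)) :
    ∫⁻ y : C.Data, ∏ t, f t (C.resid t (b t) y) = ∏ t, ∫⁻ e, f t e := by
  have hfm : ∀ t, Measurable fun y : C.Data => f t (C.resid t (b t) y) := fun t =>
    (hf t).comp ((C.measurable_resid t).comp (f := fun y : C.Data => (b t, y)) (by fun_prop))
  -- Lebesgue measure is read as a chain of constant kernels; translation invariance makes the
  -- integral at each link independent of the earlier outputs.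
  have h := lintegral_chainKer_prod (A := Unit)
    (fun t => Kernel.const (Unit × C.Data) (volume : Measure (C.X t → ℝ))) hfm
    (fun u t hut y x => by rw [C.resid_update b hut]) ()
    (c := fun t => ∫⁻ e, f t e) (fun t y => by
      simp only [resid_update_self, Kernel.const_apply]
      exact lintegral_sub_right_eq_self (f t) _) 0
  rw [← h, lintegral_chainKer_const (fun t => (volume : Measure (C.X t → ℝ))) _
    (List.nodup_finRange s) (Finset.measurable_prod _ fun t _ => hfm t), List.toFinset_finRange,
    lmarginal_univ]
  rfl

variable [DecidableEq 𝒳]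

variable {C}

section Model

variable {Ω : Type*} [MeasurableSpace Ω] {Y : Fin s → 𝒳 → Ω → ℝ} {θ : C.Param} {P : Measure Ω}

omit [DecidableEq 𝒳] in
-- The model gives measurability only for the discrepancies; that of the outputs follows by
-- unwinding the autoregression from the lowest level.
theorem IsCokrigingModel.aemeasurable (hM : C.IsCokrigingModel Y θ P) (t : Fin s) (x : 𝒳) :
    AEMeasurable (Y t x) P := by
  have key : ∀ k : ℕ, ∀ t : Fin s, (t : ℕ) = k → AEMeasurable (Y t x) P := by
    intro k
    induction k using Nat.strong_induction_on with
    | _ k ih =>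
      intro t ht
      have h1 := (hM.gaussian t).aemeasurable x
      have h2 : AEMeasurable (fun ω => ∑ u : Prev t, (θ t).1 (Sum.inr u) * Y u.1 x ω) P :=
        Finset.aemeasurable_fun_sum _ fun u _ =>
          (ih u.1 (by have := u.2; omega) u.1 rfl).const_mul _
      refine (h1.add h2).congr (ae_of_all _ fun ω => ?_)
      simp [discrepancy]
  exact key t t rfl

/-- All outputs that occur in the joint law. -/
def outputs (C : Cokriging 𝒳 s) (Y : Fin s → 𝒳 → Ω → ℝ) (x₀ : 𝒳) (ω : Ω) :
    C.Data × (Fin s → ℝ) :=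
  (fun t x => Y t x ω, fun t => Y t x₀ ω)

omit [DecidableEq 𝒳] in
theorem IsCokrigingModel.aemeasurable_outputs (hM : C.IsCokrigingModel Y θ P) (x₀ : 𝒳) :
    AEMeasurable (outputs C Y x₀) P :=
  (aemeasurable_pi_iff.mpr fun t => aemeasurable_pi_iff.mpr fun x : C.X t =>
    hM.aemeasurable t x.1).prodMk (aemeasurable_pi_iff.mpr fun t => hM.aemeasurable t x₀)

omit [DecidableEq 𝒳] [MeasurableSpace Ω] in
theorem residuals_outputs (x₀ : 𝒳) (t : Fin s) (ω : Ω) :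
    C.residuals x₀ θ (outputs C Y x₀ ω) t =
      ((fun x : C.X t => C.discrepancy Y θ t x ω - ∑ j, C.h t x j * (θ t).1 (Sum.inl j)),
        C.discrepancy Y θ t x₀ ω - ∑ j, C.h t x₀ j * (θ t).1 (Sum.inl j)) := by
  rw [residuals]
  refine Prod.ext ?_ ?_
  · ext x
    simp only [resid_apply, outputs, discrepancy, mul_comm ((θ t).1 _)]
    ring
  · simp only [resid₀_eq, outputs, discrepancy, mul_comm ((θ t).1 _)]
    ring

omit [DecidableEq 𝒳] in
-- The residuals of level `t` are a measurable function of the discrepancy process of that level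
-- alone, so they inherit independence across levels.
theorem IsCokrigingModel.map_residuals [IsProbabilityMeasure P] (hM : C.IsCokrigingModel Y θ P)
    (x₀ : 𝒳) :
    P.map (fun ω => C.residuals x₀ θ (outputs C Y x₀ ω)) =
      Measure.pi fun t => P.map fun ω => C.residuals x₀ θ (outputs C Y x₀ ω) t := by
  have hind := hM.indep.comp (fun t (f : 𝒳 → ℝ) =>
    ((fun x : C.X t => f x - ∑ j, C.h t x j * (θ t).1 (Sum.inl j)),
      f x₀ - ∑ j, C.h t x₀ j * (θ t).1 (Sum.inl j))) (fun t => by fun_prop)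
  have hind' : iIndepFun (fun t ω => C.residuals x₀ θ (outputs C Y x₀ ω) t) P := by
    convert hind using 3 with t ω
    exact residuals_outputs x₀ t _
  exact hind'.map_fun_eq_pi_map fun t => (measurable_pi_apply t).comp_aemeasurable
    ((C.measurable_residuals x₀ θ).comp_aemeasurable (hM.aemeasurable_outputs x₀))

omit [DecidableEq 𝒳] in
theorem IsCokrigingModel.isProbabilityMeasure (hM : C.IsCokrigingModel Y θ P) (t : Fin s) :
    IsProbabilityMeasure P := (hM.gaussian t).isProbabilityMeasure

/-- The law of the residuals of level `t`. -/
theorem IsCokrigingModel.lintegral_residuals (hM : C.IsCokrigingModel Y θ P) (x₀ : 𝒳) (t : Fin s)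
    (hv : 0 < (θ t).2) (hR : (C.R t).PosDef) {A : Matrix (C.X t) (C.X t) ℝ} (hA : IsUnit A.det)
    (hRA : (C.R t)⁻¹ = Aᵀ * A) :
    0 ≤ C.condVar t x₀ ∧ ∀ F : (C.X t → ℝ) × ℝ → ℝ≥0∞, Measurable F →
      ∫⁻ ω, F (C.residuals x₀ θ (outputs C Y x₀ ω) t) ∂P =
        ∫⁻ e, ENNReal.ofReal |A.det| * (∏ i, gaussianPDF 0 (θ t).2.toNNReal ((A *ᵥ e) i)) *
          ∫⁻ x, F (e, x) ∂gaussianReal (C.rvec t x₀ ⬝ᵥ ((C.R t)⁻¹ *ᵥ e))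
            ((θ t).2 * C.condVar t x₀).toNNReal := by
  have hP := hM.isProbabilityMeasure t
  set m : 𝒳 → ℝ := fun x => ∑ j, C.h t x j * (θ t).1 (Sum.inl j) with hm
  have hint : ∀ x, Integrable (C.discrepancy Y θ t x) P := fun x =>
    ((hM.gaussian t).hasGaussianLaw_eval x).integrable
  have hmean : ∀ x, ∫ ω, (C.discrepancy Y θ t x ω - m x) ∂P = 0 := fun x => by
    rw [integral_sub (hint x) (integrable_const _), hM.mean, integral_const]
    simp [hm]
  have hcov : ∀ x x', cov[fun ω => C.discrepancy Y θ t x ω - m x,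
      fun ω => C.discrepancy Y θ t x' ω - m x'; P] = (θ t).2 * C.r t x x' := fun x x' => by
    rw [covariance_sub_const_left (hint x), covariance_sub_const_right (hint x'), hM.cov]
  have hG : HasGaussianLaw (fun ω => ((fun x : C.X t => C.discrepancy Y θ t x ω - m x),
      C.discrepancy Y θ t x₀ ω - m x₀)) P := by
    -- The new input may itself be a design point. Evaluating on the set `I` and then applying the
    -- linear map `L`, which may repeat a coordinate, covers both cases.
    let I : Finset 𝒳 := insert x₀ (C.X t)
    let L : (I → ℝ) →ₗ[ℝ] (C.X t → ℝ) × ℝ :=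
      { toFun := fun f => (fun x => f ⟨x, Finset.mem_insert_of_mem x.2⟩,
          f ⟨x₀, Finset.mem_insert_self _ _⟩)
        map_add' := fun f g => rfl
        map_smul' := fun c f => rfl }
    have h1 := ((hM.gaussian t).hasGaussianLaw I).map_fun L.toContinuousLinearMap
    have h2 := h1.isGaussian_map
    refine ⟨?_⟩
    have h3 : (fun ω => ((fun x : C.X t => C.discrepancy Y θ t x ω - m x),
        C.discrepancy Y θ t x₀ ω - m x₀)) =
        (fun p : (C.X t → ℝ) × ℝ => p - ((fun x : C.X t => m x), m x₀)) ∘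
          fun ω => L.toContinuousLinearMap (I.restrict fun x => C.discrepancy Y θ t x ω) := rfl
    rw [h3, ← AEMeasurable.map_map_of_aemeasurable (by fun_prop) h1.aemeasurable]
    infer_instance
  have := HasGaussianLaw.lintegral_regression hG (fun i => hmean i) (hmean x₀) hv hR hA hRA
    (r := C.rvec t x₀) (r₀ := C.r t x₀ x₀) (fun i j => hcov i j) (fun i => hcov i x₀) (hcov x₀ x₀)
  simp only [residuals_outputs]
  exact this

end Model

variable (C)

/-- The conditional law of `y_t(x₀)` at known parameters, given the data and `y_{t-1}(x₀)`. -/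
noncomputable def condKer (x₀ : 𝒳) (t : Fin s) :
    Kernel ((C.Param × C.Data) × (Fin s → ℝ)) ℝ where
  toFun p := gaussianReal
    (C.condMean t x₀ (fun u => p.1.2 u.1) (p.1.2 t) (fun u => p.2 u.1) (p.1.1 t).1)
    ((p.1.1 t).2 * C.condVar t x₀).toNNReal
  measurable' := by
    refine measurable_gaussianReal.comp (Measurable.prodMk ?_ (by fun_prop))
    exact (measurable_condMean t x₀).comp
      (f := fun p : (C.Param × C.Data) × (Fin s → ℝ) =>
        (((fun u : Prev t => p.1.2 u.1), p.1.2 t), ((fun u : Prev t => p.2 u.1), (p.1.1 t).1)))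
      (by fun_prop)

theorem condKer_apply (x₀ : 𝒳) (t : Fin s) (θ : C.Param) (y : C.Data) (v : Fin s → ℝ) :
    C.condKer x₀ t ((θ, y), v) = gaussianReal
      (C.condMean t x₀ (fun u => y u.1) (y t) (fun u => v u.1) (θ t).1)
      ((θ t).2 * C.condVar t x₀).toNNReal := rfl

instance (x₀ : 𝒳) (t : Fin s) : IsMarkovKernel (C.condKer x₀ t) :=
  ⟨fun _ => by
    change IsProbabilityMeasure (gaussianReal _ _)
    infer_instance⟩

/-- The density of the data at level `t`, at known parameters. -/
noncomputable def dataDens (A : ∀ t, Matrix (C.X t) (C.X t) ℝ) (t : Fin s) (y : C.Data)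
    (θ : (C.Col t → ℝ) × ℝ) : ℝ≥0∞ :=
  C.levelDens t (A t) (fun u => y u.1) (y t) θ

theorem measurable_dataDens (A : ∀ t, Matrix (C.X t) (C.X t) ℝ) (t : Fin s) :
    Measurable fun p : C.Data × ((C.Col t → ℝ) × ℝ) => C.dataDens A t p.1 p.2 :=
  (measurable_levelDens t (A t)).comp
    (f := fun p : C.Data × ((C.Col t → ℝ) × ℝ) => (((fun u : Prev t => p.1 u.1), p.1 t), p.2))
    (by fun_prop)

theorem measurable_dataDens_param (A : ∀ t, Matrix (C.X t) (C.X t) ℝ) (t : Fin s) :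
    Measurable fun p : C.Param × C.Data => C.dataDens A t p.2 (p.1 t) :=
  (C.measurable_dataDens A t).comp (f := fun p : C.Param × C.Data => (p.2, p.1 t)) (by fun_prop)

/-- The law of `(y, y(x₀))` at known parameters: a density for `y`, and a chain for `y(x₀)`. -/
noncomputable def sampleLaw (A : ∀ t, Matrix (C.X t) (C.X t) ℝ) (x₀ : 𝒳) (θ : C.Param) :
    Measure (C.Data × (Fin s → ℝ)) :=
  ((volume : Measure C.Data).withDensity fun y => ∏ t, C.dataDens A t y (θ t)) ⊗ₘ
    (chainKer (C.condKer x₀) (List.finRange s)).comap (fun y => ((θ, y), 0)) (by fun_prop)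

theorem lintegral_sampleLaw (A : ∀ t, Matrix (C.X t) (C.X t) ℝ) (x₀ : 𝒳) (θ : C.Param)
    {F : C.Data × (Fin s → ℝ) → ℝ≥0∞} (hF : Measurable F) :
    ∫⁻ p, F p ∂C.sampleLaw A x₀ θ = ∫⁻ y : C.Data, (∏ t, C.dataDens A t y (θ t)) *
      ∫⁻ v, F (y, v) ∂chainKer (C.condKer x₀) (List.finRange s) ((θ, y), 0) := by
  have hd : Measurable fun y : C.Data => ∏ t, C.dataDens A t y (θ t) :=
    Finset.measurable_prod _ fun t _ => (C.measurable_dataDens_param A t).comp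
      (f := fun y : C.Data => (θ, y)) (by fun_prop)
  have := isMarkovKernel_chainKer (C.condKer x₀) (List.finRange s)
  rw [sampleLaw, Measure.lintegral_compProd hF, lintegral_withDensity_eq_lintegral_mul _ hd]
  · rfl
  · exact hF.lintegral_kernel_prod_right'

theorem measurable_lintegral_sample (A : ∀ t, Matrix (C.X t) (C.X t) ℝ) (x₀ : 𝒳)
    {F : C.Data × (Fin s → ℝ) → ℝ≥0∞} (hF : Measurable F) :
    Measurable fun p : C.Param × C.Data => (∏ t, C.dataDens A t p.2 (p.1 t)) *
      ∫⁻ v, F (p.2, v) ∂chainKer (C.condKer x₀) (List.finRange s) (p, 0) := by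
  refine (Finset.measurable_prod _ fun t _ => C.measurable_dataDens_param A t).mul ?_
  have h := Measurable.lintegral_kernel_prod_right' (κ := (chainKer (C.condKer x₀)
    (List.finRange s)).comap (fun p : C.Param × C.Data => (p, (0 : Fin s → ℝ))) (by fun_prop))
    (f := fun q : (C.Param × C.Data) × (Fin s → ℝ) => F (q.1.2, q.2)) (by fun_prop)
  exact h

theorem measurable_sampleLaw (A : ∀ t, Matrix (C.X t) (C.X t) ℝ) (x₀ : 𝒳) :
    Measurable (C.sampleLaw A x₀) := by
  refine Measure.measurable_of_measurable_coe _ fun S hS => ?_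
  have : (fun θ => C.sampleLaw A x₀ θ S) = fun θ => ∫⁻ y : C.Data,
      (∏ t, C.dataDens A t y (θ t)) * ∫⁻ v, S.indicator 1 (y, v)
        ∂chainKer (C.condKer x₀) (List.finRange s) ((θ, y), 0) := by
    ext θ
    rw [← lintegral_indicator_one hS, C.lintegral_sampleLaw A x₀ θ (measurable_one.indicator hS)]
  rw [this]
  exact (C.measurable_lintegral_sample A x₀ (measurable_one.indicator hS)).lintegral_prod_right'

variable {C}

/-- At known parameters, the model determines the law of `(y, y(x₀))`. -/
theorem IsCokrigingModel.map_outputs {Ω : Type*} [MeasurableSpace Ω] {Y : Fin s → 𝒳 → Ω → ℝ}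
    {θ : C.Param} {P : Measure Ω} [IsProbabilityMeasure P] (hM : C.IsCokrigingModel Y θ P)
    (x₀ : 𝒳) (hv : ∀ t, 0 < (θ t).2) (hR : ∀ t, (C.R t).PosDef)
    {A : ∀ t, Matrix (C.X t) (C.X t) ℝ} (hA : ∀ t, IsUnit (A t).det)
    (hRA : ∀ t, (C.R t)⁻¹ = (A t)ᵀ * A t) :
    P.map (outputs C Y x₀) = C.sampleLaw A x₀ θ := by
  have hSm := C.measurable_residuals x₀ θ
  have hE : MeasurableEmbedding (C.residuals x₀ θ) :=
    hSm.measurableEmbedding (C.injective_residuals x₀ θ)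
  have hae := hM.aemeasurable_outputs x₀
  -- The residual map is a measurable embedding, so it is enough to compare the two laws after
  -- passing to residuals, where the model gives a product measure.
  suffices h : (P.map (outputs C Y x₀)).map (C.residuals x₀ θ) =
      (C.sampleLaw A x₀ θ).map (C.residuals x₀ θ) by
    ext S hS
    rw [← hE.injective.preimage_image S, ← hE.map_apply, ← hE.map_apply, h]
  rw [AEMeasurable.map_map_of_aemeasurable hSm.aemeasurable hae]
  refine (hM.map_residuals x₀).trans ?_
  have hres : ∀ t, AEMeasurable (fun ω => C.residuals x₀ θ (outputs C Y x₀ ω) t) P := fun t =>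
    (measurable_pi_apply t).comp_aemeasurable (hSm.comp_aemeasurable hae)
  have hprob : ∀ t, IsProbabilityMeasure
      (P.map fun ω => C.residuals x₀ θ (outputs C Y x₀ ω) t) := fun t =>
    Measure.isProbabilityMeasure_map (hres t)
  refine Measure.pi_eq fun S hS => ?_
  have hSpi : MeasurableSet (Set.univ.pi S) := MeasurableSet.univ_pi hS
  -- the factor of level `t`
  set g : ∀ t, (C.X t → ℝ) → ℝ≥0∞ := fun t e => ∫⁻ x, (S t).indicator 1 (e, x)
    ∂gaussianReal (C.rvec t x₀ ⬝ᵥ ((C.R t)⁻¹ *ᵥ e)) ((θ t).2 * C.condVar t x₀).toNNReal with hg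
  have hrhs : ∀ t, P.map (fun ω => C.residuals x₀ θ (outputs C Y x₀ ω) t) (S t) =
      ∫⁻ e, ENNReal.ofReal |(A t).det| *
        (∏ i, gaussianPDF 0 (θ t).2.toNNReal ((A t *ᵥ e) i)) * g t e := fun t => by
    have hi : Measurable ((S t).indicator (1 : (C.X t → ℝ) × ℝ → ℝ≥0∞)) :=
      measurable_one.indicator (hS t)
    rw [← lintegral_indicator_one (hS t), lintegral_map' hi.aemeasurable (hres t)]
    exact (hM.lintegral_residuals x₀ t (hv t) (hR t) (hA t) (hRA t)).2 _ hi
  have hgm : ∀ t, Measurable (g t) := fun t => by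
    have hf : Measurable fun e : C.X t → ℝ => C.rvec t x₀ ⬝ᵥ ((C.R t)⁻¹ *ᵥ e) := by
      simp only [Matrix.mulVec, dotProduct]
      fun_prop
    let κ : Kernel (C.X t → ℝ) ℝ :=
      { toFun := fun e => gaussianReal (C.rvec t x₀ ⬝ᵥ ((C.R t)⁻¹ *ᵥ e))
          ((θ t).2 * C.condVar t x₀).toNNReal
        measurable' := measurable_gaussianReal.comp (hf.prodMk measurable_const) }
    have : IsMarkovKernel κ := ⟨fun e => by
      change IsProbabilityMeasure (gaussianReal _ _)
      infer_instance⟩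
    exact Measurable.lintegral_kernel_prod_right' (κ := κ) (measurable_one.indicator (hS t))
  have hind : (C.residuals x₀ θ ⁻¹' Set.univ.pi S).indicator (1 : C.Data × (Fin s → ℝ) → ℝ≥0∞) =
      fun p => ∏ t, (S t).indicator 1 (C.residuals x₀ θ p t) := by
    ext p
    by_cases hp : p ∈ C.residuals x₀ θ ⁻¹' Set.univ.pi S
    · rw [Set.indicator_of_mem hp, Pi.one_apply, eq_comm]
      exact Finset.prod_eq_one fun t _ => Set.indicator_of_mem (hp t trivial) _
    · rw [Set.indicator_of_notMem hp]
      simp only [Set.mem_preimage, Set.mem_pi, Set.mem_univ, forall_const, not_forall] at hp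
      obtain ⟨t, ht⟩ := hp
      exact (Finset.prod_eq_zero (Finset.mem_univ t) (Set.indicator_of_notMem ht _)).symm
  rw [Measure.map_apply hSm hSpi, ← lintegral_indicator_one (hSm hSpi), C.lintegral_sampleLaw A x₀ θ
    (measurable_one.indicator (hSm hSpi)), hind]
  simp only [hrhs]
  -- The product of level integrals is reassembled into one integral over `y`; for each `y`, the
  -- factors at `x₀` are then reassembled along the chain in `v`.
  rw [← C.lintegral_prod_resid (fun t => (θ t).1)]
  · refine lintegral_congr fun y => ?_
    have hchain := lintegral_chainKer_prod (C.condKer x₀)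
      (f := fun t v => (S t).indicator 1 (C.resid t (θ t).1 y, C.resid₀ x₀ t (θ t).1 v))
      (a := (θ, y)) (c := fun t => g t (C.resid t (θ t).1 y)) ?_ ?_ ?_ 0
    · rw [Finset.prod_mul_distrib, ← hchain]
      rfl
    · intro t
      exact (measurable_one.indicator (hS t)).comp
        (measurable_const.prodMk ((C.measurable_resid₀ x₀ t).comp
          (f := fun v : Fin s → ℝ => ((θ t).1, v)) (by fun_prop)))
    · intro u t hut v x
      rw [C.resid₀_update x₀ (fun t => (θ t).1) hut]
    · intro t v
      have hi : Measurable fun x => (S t).indicator (1 : (C.X t → ℝ) × ℝ → ℝ≥0∞) (C.resid t (θ t).1 y, x) :=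
        (measurable_one.indicator (hS t)).comp measurable_prodMk_left
      simp only [resid₀_update_self, condKer_apply]
      have hmap := lintegral_map (μ := gaussianReal
          (C.condMean t x₀ (fun u => y u.1) (y t) (fun u => v u.1) (θ t).1)
          ((θ t).2 * C.condVar t x₀).toNNReal) hi
        (g := fun x => x - C.X0 t x₀ (fun u => v u.1) ⬝ᵥ (θ t).1) (by fun_prop)
      rw [← hmap, gaussianReal_map_sub_const, condMean, add_sub_cancel_left]
      rfl
  · intro t
    refine Measurable.mul (Measurable.const_mul (Finset.measurable_prod _ fun i _ => ?_) _) (hgm t)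
    refine (measurable_gaussianPDF 0 _).comp ?_
    simp only [Matrix.mulVec, dotProduct]
    fun_prop

end Cokriging

/-! ### Measurability of the predictive formulas -/

/-- By Cramer's rule the inverse is the adjugate times the inverse determinant. With `0⁻¹ = 0` this
also covers singular matrices. -/
theorem measurable_matrix_inv_apply {α κ : Type*} [MeasurableSpace α] [Fintype κ] [DecidableEq κ]
    {M : α → Matrix κ κ ℝ} (hM : ∀ i j, Measurable fun a => M a i j) (i j : κ) :
    Measurable fun a => (M a)⁻¹ i j := by
  have hM' : Measurable fun a => (fun i j => M a i j : κ → κ → ℝ) :=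
    measurable_pi_iff.mpr fun i => measurable_pi_iff.mpr fun j => hM i j
  have hdet : Measurable fun a => (M a).det := by
    have : Continuous fun N : κ → κ → ℝ => (Matrix.of N).det :=
      Continuous.matrix_det (continuous_id (X := κ → κ → ℝ))
    exact this.measurable.comp hM'
  have hadj : Measurable fun a => (M a).adjugate i j := by
    have : Continuous fun N : κ → κ → ℝ => (Matrix.of N).adjugate i j :=
      (Continuous.matrix_adjugate (continuous_id (X := κ → κ → ℝ))).matrix_elem i j
    exact this.measurable.comp hM'
  simp only [Matrix.inv_def, Matrix.smul_apply, Ring.inverse_eq_inv', smul_eq_mul]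
  exact hdet.inv.mul hadj

theorem measurable_studentT (ν : ℝ) : Measurable fun p : ℝ × ℝ => studentT ν p.1 p.2 := by
  refine Measure.measurable_of_measurable_coe _ fun S hS => ?_
  have hi : Measurable (S.indicator (1 : ℝ → ℝ≥0∞)) := measurable_one.indicator hS
  have : (fun p : ℝ × ℝ => studentT ν p.1 p.2 S) = fun p => ∫⁻ x,
      ENNReal.ofReal (studentTPDF ν x) * S.indicator 1 (p.1 + Real.sqrt p.2 * x) := by
    ext p
    rw [← lintegral_indicator_one hS, lintegral_studentT hi]
  rw [this]
  have hm := measurable_studentTPDF ν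
  refine Measurable.lintegral_prod_right' (f := fun q : (ℝ × ℝ) × ℝ =>
    ENNReal.ofReal (studentTPDF ν q.2) * S.indicator 1 (q.1.1 + Real.sqrt q.1.2 * q.2)) ?_
  fun_prop

namespace Cokriging

variable {𝒳 : Type*} {s : ℕ} (C : Cokriging 𝒳 s)

theorem measurable_Xmat_apply (t : Fin s) (x : C.X t) (j : C.Col t) :
    Measurable fun yp : C.PrevData t => C.Xmat t yp x j := by
  cases j <;> simp only [Xmat, Matrix.of_apply, Sum.elim_inl, Sum.elim_inr] <;> fun_prop

theorem measurable_X0_apply (t : Fin s) (x₀ : 𝒳) (j : C.Col t) :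
    Measurable fun w : Prev t → ℝ => C.X0 t x₀ w j := by
  cases j <;> simp only [X0, Sum.elim_inl, Sum.elim_inr] <;> fun_prop

variable [DecidableEq 𝒳]

theorem measurable_gram_apply (t : Fin s) (i j : C.Col t) :
    Measurable fun yp : C.PrevData t => C.gram t yp i j := by
  have h := C.measurable_Xmat_apply t
  simp only [gram, Matrix.mul_apply, Matrix.transpose_apply]
  fun_prop

theorem measurable_gram_inv_apply (t : Fin s) (i j : C.Col t) :
    Measurable fun yp : C.PrevData t => (C.gram t yp)⁻¹ i j :=
  measurable_matrix_inv_apply (C.measurable_gram_apply t) i j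

theorem measurable_bhat_apply (t : Fin s) (j : C.Col t) :
    Measurable fun p : C.PrevData t × (C.X t → ℝ) => C.bhat t p.1 p.2 j := by
  have h : ∀ x j, Measurable fun p : C.PrevData t × (C.X t → ℝ) => C.Xmat t p.1 x j :=
    fun x j => (C.measurable_Xmat_apply t x j).comp measurable_fst
  have h' : ∀ i j, Measurable fun p : C.PrevData t × (C.X t → ℝ) => (C.gram t p.1)⁻¹ i j :=
    fun i j => (C.measurable_gram_inv_apply t i j).comp measurable_fst
  have hM : ∀ x, Measurable fun p : C.PrevData t × (C.X t → ℝ) =>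
      ((C.gram t p.1)⁻¹ * (C.Xmat t p.1)ᵀ * (C.R t)⁻¹) j x := fun x => by
    simp only [Matrix.mul_apply, Matrix.transpose_apply]
    exact Finset.measurable_fun_sum _ fun z _ => (Finset.measurable_fun_sum _ fun i _ =>
      (h' j i).mul (h z i)).mul_const _
  refine Finset.measurable_fun_sum _ fun x _ => (hM x).mul ?_
  exact (measurable_pi_apply x).comp measurable_snd

theorem measurable_fit_apply (t : Fin s) (x : C.X t) :
    Measurable fun p : C.PrevData t × (C.X t → ℝ) =>
      (C.Xmat t p.1 *ᵥ C.bhat t p.1 p.2) x := by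
  have h : ∀ x j, Measurable fun p : C.PrevData t × (C.X t → ℝ) => C.Xmat t p.1 x j :=
    fun x j => (C.measurable_Xmat_apply t x j).comp measurable_fst
  have h' := C.measurable_bhat_apply t
  simp only [Matrix.mulVec, dotProduct]
  fun_prop

theorem measurable_sigmaHatSq (t : Fin s) :
    Measurable fun p : C.PrevData t × (C.X t → ℝ) => C.sigmaHatSq t p.1 p.2 := by
  have h := C.measurable_fit_apply t
  simp only [sigmaHatSq, gss]
  refine Measurable.div_const ?_ _
  simp only [dotProduct, Pi.sub_apply]
  refine Finset.measurable_fun_sum _ fun x _ => ?_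
  refine Measurable.mul (by fun_prop) ?_
  change Measurable fun p : C.PrevData t × (C.X t → ℝ) =>
    ∑ z, (C.R t)⁻¹ x z * (p.2 z - (C.Xmat t p.1 *ᵥ C.bhat t p.1 p.2) z)
  fun_prop

theorem measurable_predMean (t : Fin s) (x₀ : 𝒳) :
    Measurable fun p : (C.PrevData t × (C.X t → ℝ)) × (Prev t → ℝ) =>
      C.predMean t x₀ p.1.1 p.1.2 p.2 := by
  have h1 : ∀ x, Measurable fun p : (C.PrevData t × (C.X t → ℝ)) × (Prev t → ℝ) =>
      (C.Xmat t p.1.1 *ᵥ C.bhat t p.1.1 p.1.2) x :=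
    fun x => (C.measurable_fit_apply t x).comp measurable_fst
  have h2 : ∀ j, Measurable fun p : (C.PrevData t × (C.X t → ℝ)) × (Prev t → ℝ) =>
      C.bhat t p.1.1 p.1.2 j :=
    fun j => (C.measurable_bhat_apply t j).comp measurable_fst
  have h3 : ∀ j, Measurable fun p : (C.PrevData t × (C.X t → ℝ)) × (Prev t → ℝ) =>
      C.X0 t x₀ p.2 j :=
    fun j => (C.measurable_X0_apply t x₀ j).comp measurable_snd
  simp only [predMean]
  refine Measurable.add ?_ ?_
  · simp only [dotProduct]
    fun_prop
  · simp only [dotProduct]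
    refine Finset.measurable_fun_sum _ fun x _ => ?_
    refine Measurable.const_mul ?_ _
    change Measurable fun p : (C.PrevData t × (C.X t → ℝ)) × (Prev t → ℝ) =>
      ∑ z, (C.R t)⁻¹ x z * (p.1.2 z - (C.Xmat t p.1.1 *ᵥ C.bhat t p.1.1 p.1.2) z)
    fun_prop

theorem measurable_avec_apply (t : Fin s) (x₀ : 𝒳) (j : C.Col t) :
    Measurable fun p : C.PrevData t × (Prev t → ℝ) => C.avec t x₀ p.1 p.2 j := by
  have h1 : ∀ x j, Measurable fun p : C.PrevData t × (Prev t → ℝ) => C.Xmat t p.1 x j :=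
    fun x j => (C.measurable_Xmat_apply t x j).comp measurable_fst
  have h3 : ∀ j, Measurable fun p : C.PrevData t × (Prev t → ℝ) => C.X0 t x₀ p.2 j :=
    fun j => (C.measurable_X0_apply t x₀ j).comp measurable_snd
  simp only [avec, Pi.sub_apply, Matrix.mulVec, dotProduct, Matrix.mul_apply,
    Matrix.transpose_apply]
  fun_prop

theorem measurable_cstar (t : Fin s) (x₀ : 𝒳) :
    Measurable fun p : C.PrevData t × (Prev t → ℝ) => C.cstar t x₀ p.1 p.2 := by
  have h1 := C.measurable_avec_apply t x₀
  have h2 : ∀ i j, Measurable fun p : C.PrevData t × (Prev t → ℝ) => (C.gram t p.1)⁻¹ i j :=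
    fun i j => (C.measurable_gram_inv_apply t i j).comp measurable_fst
  simp only [cstar]
  refine Measurable.const_add ?_ _
  have h3 : ∀ i, Measurable fun p : C.PrevData t × (Prev t → ℝ) =>
      ((C.gram t p.1)⁻¹ *ᵥ C.avec t x₀ p.1 p.2) i := fun i => by
    simp only [Matrix.mulVec, dotProduct]
    exact Finset.measurable_fun_sum _ fun j _ => (h2 i j).mul (h1 j)
  exact Finset.measurable_fun_sum _ fun i _ => (h1 i).mul (h3 i)

/-- The predictive Student distribution of a level, as a kernel. -/
noncomputable def levelKer (t : Fin s) (x₀ : 𝒳) :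
    Kernel ((C.PrevData t × (C.X t → ℝ)) × (Prev t → ℝ)) ℝ where
  toFun p := C.levelLaw t x₀ p.1.1 p.1.2 p.2
  measurable' := by
    refine (measurable_studentT _).comp
      (f := fun p : (C.PrevData t × (C.X t → ℝ)) × (Prev t → ℝ) =>
        (C.predMean t x₀ p.1.1 p.1.2 p.2, C.sigmaHatSq t p.1.1 p.1.2 * C.cstar t x₀ p.1.1 p.2)) ?_
    refine (C.measurable_predMean t x₀).prodMk (Measurable.mul ?_ ?_)
    · exact (C.measurable_sigmaHatSq t).comp measurable_fst
    · exact (C.measurable_cstar t x₀).comp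
        (f := fun p : (C.PrevData t × (C.X t → ℝ)) × (Prev t → ℝ) => (p.1.1, p.2)) (by fun_prop)

variable {C}

theorem isProbabilityMeasure_levelLaw {t : Fin s} (hq : C.q t < C.n t) (x₀ : 𝒳)
    (yp : C.PrevData t) (y : C.X t → ℝ) (w : Prev t → ℝ) :
    IsProbabilityMeasure (C.levelLaw t x₀ yp y w) := by
  have : (C.q t : ℝ) < C.n t := by exact_mod_cast hq
  exact isProbabilityMeasure_studentT (by linarith) _ _

theorem isMarkovKernel_levelKer {t : Fin s} (hq : C.q t < C.n t) (x₀ : 𝒳) :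
    IsMarkovKernel (C.levelKer t x₀) :=
  ⟨fun p => isProbabilityMeasure_levelLaw hq x₀ p.1.1 p.1.2 p.2⟩

/-! ### Degenerate data form a null set -/

/-- `R_t⁻¹` is positive definite, so the residual sum of squares can fail to be positive only if the
fit is exact. -/
theorem mem_range_of_sigmaHatSq_nonpos {t : Fin s} (hR : (C.R t).PosDef) (hq : C.q t < C.n t)
    {yp : C.PrevData t} {y : C.X t → ℝ} (h : C.sigmaHatSq t yp y ≤ 0) :
    y ∈ LinearMap.range (C.Xmat t yp).mulVecLin := by
  have hν : (0 : ℝ) < (C.n t : ℝ) - C.q t := by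
    have : (C.q t : ℝ) < C.n t := by exact_mod_cast hq
    linarith
  have h1 : C.gss t yp y (C.bhat t yp y) ≤ 0 := by
    by_contra hc
    exact absurd h (not_le.mpr (div_pos (not_le.mp hc) hν))
  refine ⟨C.bhat t yp y, ?_⟩
  by_contra hne
  have h2 := hR.inv.dotProduct_mulVec_pos (sub_ne_zero.mpr (Ne.symm hne))
  rw [star_trivial] at h2
  exact absurd h2 (not_lt.mpr h1)

omit [DecidableEq 𝒳] in
theorem volume_range_Xmat {t : Fin s} (hq : C.q t < C.n t) (yp : C.PrevData t) :
    volume (LinearMap.range (C.Xmat t yp).mulVecLin : Set (C.X t → ℝ)) = 0 := by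
  refine Measure.addHaar_submodule _ _ fun htop => ?_
  have h1 := LinearMap.finrank_range_le (C.Xmat t yp).mulVecLin
  rw [htop, finrank_top, Module.finrank_fintype_fun_eq_card, Module.finrank_fintype_fun_eq_card,
    Fintype.card_coe] at h1
  exact absurd hq (not_lt.mpr h1)

/-- Almost surely the residual sum of squares is positive. -/
theorem ae_sigmaHatSq_pos {t : Fin s} (hR : (C.R t).PosDef) (hq : C.q t < C.n t) :
    ∀ᵐ y : C.Data, 0 < C.sigmaHatSq t (fun u => y u.1) (y t) := by
  have hm : Measurable fun y : C.Data => C.sigmaHatSq t (fun u => y u.1) (y t) :=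
    (C.measurable_sigmaHatSq t).comp
      (f := fun y : C.Data => ((fun u : Prev t => y u.1), y t)) (by fun_prop)
  set B : Set C.Data := {y | C.sigmaHatSq t (fun u => y u.1) (y t) ≤ 0} with hB
  have hBm : MeasurableSet B := measurableSet_le hm measurable_const
  have hi : Measurable (B.indicator (1 : C.Data → ℝ≥0∞)) := measurable_one.indicator hBm
  have h0 : volume B = 0 := by
    -- Integrate over `y_t` first: with the other levels fixed, `X_t` is a fixed matrix and the
    -- exceptional `y_t` lie in its range, a proper subspace.
    rw [← lintegral_indicator_one hBm, volume_pi, lintegral_eq_lmarginal_univ (0 : C.Data),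
      lmarginal_erase' _ hi (Finset.mem_univ t)]
    have : (fun y : C.Data => ∫⁻ x, B.indicator 1 (Function.update y t x)) = fun _ => 0 := by
      ext y
      have hsub : ∀ x, Function.update y t x ∈ B →
          x ∈ LinearMap.range (C.Xmat t fun u => y u.1).mulVecLin := fun x hx => by
        have h2 : (fun u : Prev t => Function.update y t x u.1) = fun u : Prev t => y u.1 :=
          funext fun u => Function.update_of_ne (Prev.lt u).ne _ _
        rw [hB, Set.mem_ofPred_eq, h2, Function.update_self] at hx
        exact mem_range_of_sigmaHatSq_nonpos hR hq hx
      have hmi : Measurable fun x => B.indicator (1 : C.Data → ℝ≥0∞) (Function.update y t x) :=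
        hi.comp (measurable_update y)
      refine (lintegral_eq_zero_iff hmi).mpr ?_
      have := measure_eq_zero_iff_ae_notMem.mp (volume_range_Xmat hq fun u => y u.1)
      filter_upwards [this] with x hx
      exact Set.indicator_of_notMem (fun h => hx (hsub x h)) _
    rw [this]
    simp [lmarginal]
  filter_upwards [measure_eq_zero_iff_ae_notMem.mp h0] with y hy
  exact not_le.mp hy

omit [DecidableEq 𝒳] in
-- Restriction to `𝒳_t` of the preceding level's data is a surjective linear map, so the preimage of
-- the proper subspace spanned by the basis functions is again a proper subspace.
theorem volume_prev_mem_range_H {t : Fin s} (hH : (C.H t).rank = C.p t) (hq : C.q t < C.n t)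
    (u : Prev t) :
    ∀ᵐ y : C.Data, (fun x : C.X t => y u.1 ⟨x, C.nested t u x.2⟩) ∉
      LinearMap.range (C.H t).mulVecLin := by
  classical
  let L : C.Data →ₗ[ℝ] (C.X t → ℝ) :=
    { toFun := fun y x => y u.1 ⟨x, C.nested t u x.2⟩
      map_add' := fun _ _ => rfl
      map_smul' := fun _ _ => rfl }
  have hL : Function.Surjective L := fun z => by
    -- Extension by zero from the smaller design to the preceding one.
    refine ⟨Function.update 0 u.1 fun x => if h : x.1 ∈ C.X t then z ⟨x, h⟩ else 0, ?_⟩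
    ext x
    simp [L]
  have h0 : volume ((LinearMap.range (C.H t).mulVecLin).comap L : Set C.Data) = 0 := by
    refine Measure.addHaar_submodule _ _ fun htop => ?_
    have h1 : LinearMap.range (C.H t).mulVecLin = ⊤ := by
      rw [Submodule.eq_top_iff'] at htop ⊢
      intro z
      obtain ⟨y, rfl⟩ := hL z
      exact htop y
    have h2 : (C.H t).rank = C.n t := by
      rw [Matrix.rank, h1, finrank_top, Module.finrank_fintype_fun_eq_card, Fintype.card_coe, n]
    have h3 : C.p t ≤ C.q t := by
      simp [q, Fintype.card_sum]
    omega
  exact measure_eq_zero_iff_ae_notMem.mp h0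

/-- The columns of `H_t` are independent and the column `y_{t-1}` lies outside their span, so `X_t`
is injective and the Gram matrix is positive definite. -/
theorem isUnit_det_gram {t : Fin s} (hR : (C.R t).PosDef) (hH : (C.H t).rank = C.p t)
    {y : C.Data} (hy : ∀ u : Prev t, (fun x : C.X t => y u.1 ⟨x, C.nested t u x.2⟩) ∉
      LinearMap.range (C.H t).mulVecLin) :
    IsUnit (C.gram t fun u => y u.1).det := by
  have hHinj : Function.Injective (C.H t).mulVec := by
    have h := LinearMap.finrank_range_add_finrank_ker (C.H t).mulVecLin
    rw [← Matrix.rank, hH, Module.finrank_fintype_fun_eq_card, Fintype.card_fin] at h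
    have h0 : LinearMap.ker (C.H t).mulVecLin = ⊥ := Submodule.finrank_eq_zero.mp (by omega)
    exact LinearMap.ker_eq_bot.mp h0
  have hinj : Function.Injective (C.Xmat t fun u => y u.1).mulVec := by
    have hker : ∀ d, (C.Xmat t fun u => y u.1) *ᵥ d = 0 → d = 0 := by
      intro d hd
      have hrow : ∀ x : C.X t, (C.H t *ᵥ fun j => d (Sum.inl j)) x +
          ∑ u : Prev t, y u.1 ⟨x, C.nested t u x.2⟩ * d (Sum.inr u) = 0 := fun x => by
        simpa [Matrix.mulVec, dotProduct, Xmat, H] using congrFun hd x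
      have hsub : Subsingleton (Prev t) :=
        ⟨fun a b => Subtype.ext (Fin.ext (by have := a.2; have := b.2; omega))⟩
      have hγ : ∀ u : Prev t, d (Sum.inr u) = 0 := by
        intro u
        by_contra hne
        -- Solving the linear relation for `y_{t-1}` would put it in the range of `H_t`.
        refine hy u ⟨-(d (Sum.inr u))⁻¹ • fun j => d (Sum.inl j), ?_⟩
        ext x
        have := hrow x
        rw [Fintype.sum_subsingleton _ u] at this
        rw [Matrix.mulVecLin_apply, Matrix.mulVec_smul, Pi.smul_apply, smul_eq_mul,
          eq_neg_of_add_eq_zero_left this]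
        field_simp
      have hβ : (fun j => d (Sum.inl j)) = 0 := by
        refine hHinj ?_
        rw [Matrix.mulVec_zero]
        ext x
        simpa [hγ] using hrow x
      ext j
      cases j with
      | inl j => exact congrFun hβ j
      | inr u => exact hγ u
    intro a b hab
    refine sub_eq_zero.mp (hker _ ?_)
    rw [Matrix.mulVec_sub, sub_eq_zero]
    exact hab
  have hpd := hR.inv.conjTranspose_mul_mul_same hinj
  rw [Matrix.conjTranspose_eq_transpose_of_trivial] at hpd
  exact hpd.det_pos.ne'.isUnit

/-- For almost all data the predictive formulas are non-degenerate. -/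
theorem ae_nondegenerate (hR : ∀ t, (C.R t).PosDef) (hH : ∀ t, (C.H t).rank = C.p t)
    (hq : ∀ t, C.q t < C.n t) :
    ∀ᵐ y : C.Data, ∀ t, IsUnit (C.gram t fun u => y u.1).det ∧
      0 < C.sigmaHatSq t (fun u => y u.1) (y t) := by
  rw [ae_all_iff]
  intro t
  have h1 : ∀ᵐ y : C.Data, ∀ u : Prev t, (fun x : C.X t => y u.1 ⟨x, C.nested t u x.2⟩) ∉
      LinearMap.range (C.H t).mulVecLin :=
    ae_all_iff.mpr fun u => volume_prev_mem_range_H (hH t) (hq t) u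
  filter_upwards [h1, ae_sigmaHatSq_pos (hR t) (hq t)] with y hy hy'
  exact ⟨isUnit_det_gram (hR t) (hH t) hy, hy'⟩

end Cokriging

/-! ### Integrating out all parameters -/

namespace Cokriging

variable {𝒳 : Type*} {s : ℕ} [DecidableEq 𝒳] (C : Cokriging 𝒳 s)

/-- The predictive Student distribution of level `t`, as a kernel on all the data and all the
outputs at `x₀`. -/
noncomputable def predKer (x₀ : 𝒳) (t : Fin s) : Kernel (C.Data × (Fin s → ℝ)) ℝ :=
  (C.levelKer t x₀).comap (fun p => (((fun u : Prev t => p.1 u.1), p.1 t), fun u => p.2 u.1))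
    (by fun_prop)

theorem predKer_apply (x₀ : 𝒳) (t : Fin s) (y : C.Data) (v : Fin s → ℝ) :
    C.predKer x₀ t (y, v) = C.levelLaw t x₀ (fun u => y u.1) (y t) (fun u => v u.1) := rfl

/-- The marginal density of the data at level `t`, given the data at the preceding level. -/
noncomputable def margDens (A : ∀ t, Matrix (C.X t) (C.X t) ℝ) (t : Fin s) (y : C.Data) : ℝ≥0∞ :=
  ∫⁻ θ, C.dataDens A t y θ ∂C.levelPrior t

theorem measurable_margDens (A : ∀ t, Matrix (C.X t) (C.X t) ℝ) (t : Fin s) :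
    Measurable (C.margDens A t) :=
  (C.measurable_dataDens A t).lintegral_prod_right'

variable {C}

theorem isMarkovKernel_predKer {t : Fin s} (hq : C.q t < C.n t) (x₀ : 𝒳) :
    IsMarkovKernel (C.predKer x₀ t) := by
  have := isMarkovKernel_levelKer hq x₀
  unfold predKer
  infer_instance

/-- At non-degenerate data, integrating out the parameters of a level gives its predictive
Student distribution. -/
theorem lintegral_dataDens {t : Fin s} (hR : (C.R t).PosDef) (hq : C.q t < C.n t) {x₀ : 𝒳}
    (hc : 0 ≤ C.condVar t x₀) {A : ∀ t, Matrix (C.X t) (C.X t) ℝ} (hA : IsUnit (A t).det)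
    (hRA : (C.R t)⁻¹ = (A t)ᵀ * A t) {y : C.Data} (hg : IsUnit (C.gram t fun u => y u.1).det)
    (hS : 0 < C.sigmaHatSq t (fun u => y u.1) (y t)) :
    C.margDens A t y ≠ 0 ∧ C.margDens A t y ≠ ∞ ∧
      ∀ (w : Prev t → ℝ) (G : ℝ → ℝ≥0∞), Measurable G →
        ∫⁻ θ, C.dataDens A t y θ * ∫⁻ x, G x ∂gaussianReal
            (C.condMean t x₀ (fun u => y u.1) (y t) w θ.1) (θ.2 * C.condVar t x₀).toNNReal
          ∂C.levelPrior t =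
        C.margDens A t y * ∫⁻ x, G x ∂C.levelLaw t x₀ (fun u => y u.1) (y t) w := by
  obtain ⟨m, hm0, hm, h⟩ := exists_lintegral_levelDens hR hq hc hA hRA hg hS
  -- Taking `G = 1` identifies the constant, since both conditional laws have mass one.
  have hmarg : C.margDens A t y = m := by
    have h1 := h 0 (fun _ => 1) measurable_const
    have := isProbabilityMeasure_levelLaw hq x₀ (fun u => y u.1) (y t) 0
    simp only [lintegral_const, measure_univ, mul_one] at h1
    exact h1
  rw [hmarg]
  exact ⟨hm0, hm, h⟩

/-- At non-degenerate data, integrating out all the parameters gives the chain of the predictive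
Student distributions. -/
theorem lintegral_refPrior (hR : ∀ t, (C.R t).PosDef) (hq : ∀ t, C.q t < C.n t) {x₀ : 𝒳}
    (hc : ∀ t, 0 ≤ C.condVar t x₀) {A : ∀ t, Matrix (C.X t) (C.X t) ℝ}
    (hA : ∀ t, IsUnit (A t).det) (hRA : ∀ t, (C.R t)⁻¹ = (A t)ᵀ * A t) {y : C.Data}
    (hy : ∀ t, IsUnit (C.gram t fun u => y u.1).det ∧
      0 < C.sigmaHatSq t (fun u => y u.1) (y t))
    {F : (Fin s → ℝ) → ℝ≥0∞} (hF : Measurable F) :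
    ∫⁻ θ, (∏ t, C.dataDens A t y (θ t)) *
        ∫⁻ v, F v ∂chainKer (C.condKer x₀) (List.finRange s) ((θ, y), 0) ∂C.refPrior =
      (∏ t, C.margDens A t y) * ∫⁻ v, F v ∂chainKer (C.predKer x₀) (List.finRange s) (y, 0) := by
  have := fun t => isMarkovKernel_predKer (hq t) x₀
  have hf : ∀ t, Measurable fun θ => C.dataDens A t y θ := fun t =>
    (C.measurable_dataDens A t).comp (f := fun θ : (C.Col t → ℝ) × ℝ => (y, θ)) (by fun_prop)
  have hk : ∀ t (θ θ' : C.Param) v, θ t = θ' t →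
      C.condKer x₀ t ((θ, y), v) = C.condKer x₀ t ((θ', y), v) := fun t θ θ' v hθ => by
    rw [condKer_apply, condKer_apply, hθ]
  have hκ : ∀ t (θ : C.Param) v (G : ℝ → ℝ≥0∞), Measurable G →
      ∫⁻ x, C.dataDens A t y x * ∫⁻ z, G z ∂C.condKer x₀ t ((Function.update θ t x, y), v)
        ∂C.levelPrior t = C.margDens A t y * ∫⁻ z, G z ∂C.predKer x₀ t (y, v) :=
    fun t θ v G hG => by
      simp only [condKer_apply, predKer_apply, Function.update_self]
      exact (lintegral_dataDens (hR t) (hq t) (hc t) (hA t) (hRA t) (hy t).1 (hy t).2).2.2 _ G hG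
  have h := lmarginal_lintegral_chainKer C.levelPrior (C.condKer x₀) (C.predKer x₀) y
    (f := fun t θ => C.dataDens A t y θ) hf (fun t => C.margDens A t y) hk hκ
    hF (List.finRange s) (List.nodup_finRange s) (fun _ => (0, 0)) 0
  rw [List.toFinset_finRange, lmarginal_univ] at h
  rw [refPrior_eq]
  simp only [Fin.prod_univ_def]
  exact h

omit [DecidableEq 𝒳] in
theorem ae_refPrior_pos : ∀ᵐ θ ∂C.refPrior, ∀ t, 0 < (θ t).2 := by
  rw [refPrior_eq, ae_all_iff]
  intro t
  have h : ∀ᵐ x ∂C.levelPrior t, 0 < x.2 := ?_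
  · exact (Measure.tendsto_eval_ae_ae (i := t) (μ := C.levelPrior)).eventually h
  refine Measure.quasiMeasurePreserving_snd.ae (p := fun x => 0 < x) ?_
  exact (withDensity_absolutelyContinuous _ _).ae_le (ae_restrict_mem measurableSet_Ioi)

section JointLaw

variable {Ω : Type*} [MeasurableSpace Ω] {Y : Fin s → 𝒳 → Ω → ℝ} {P : C.Param → Measure Ω}

/-- The model is assumed only for positive variances, but these carry the whole prior, so `P θ` can
be replaced by the explicit law under the integral. -/
theorem jointLaw_refPrior (hP : ∀ θ : C.Param, (∀ t, 0 < (θ t).2) → C.IsCokrigingModel Y θ (P θ))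
    (hR : ∀ t, (C.R t).PosDef) {A : ∀ t, Matrix (C.X t) (C.X t) ℝ} (hA : ∀ t, IsUnit (A t).det)
    (hRA : ∀ t, (C.R t)⁻¹ = (A t)ᵀ * A t) (c : ℝ≥0∞) (x₀ : 𝒳) :
    C.jointLaw Y P (c • C.refPrior) x₀ = c • C.refPrior.bind (C.sampleLaw A x₀) := by
  rw [jointLaw, Measure.bind_smul]
  congr 1
  refine Measure.bind_congr_right ?_
  filter_upwards [ae_refPrior_pos] with θ hθ
  have hM := hP θ hθ
  -- Independence provides this even for `s = 0`, where there is no Gaussian process to provide it.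
  have := hM.indep.isProbabilityMeasure
  exact hM.map_outputs x₀ hθ hR hA hRA

/-- The joint law disintegrates into a density for the data and the chain of the predictive
Student distributions. -/
theorem lintegral_jointLaw
    (hP : ∀ θ : C.Param, (∀ t, 0 < (θ t).2) → C.IsCokrigingModel Y θ (P θ))
    (hR : ∀ t, (C.R t).PosDef) (hH : ∀ t, (C.H t).rank = C.p t) (hq : ∀ t, C.q t < C.n t)
    {A : ∀ t, Matrix (C.X t) (C.X t) ℝ} (hA : ∀ t, IsUnit (A t).det)
    (hRA : ∀ t, (C.R t)⁻¹ = (A t)ᵀ * A t) (c : ℝ≥0∞) {x₀ : 𝒳} (hc : ∀ t, 0 ≤ C.condVar t x₀)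
    {F : C.Data × (Fin s → ℝ) → ℝ≥0∞} (hF : Measurable F) :
    ∫⁻ p, F p ∂C.jointLaw Y P (c • C.refPrior) x₀ =
      ∫⁻ y : C.Data, (c * ∏ t, C.margDens A t y) *
        ∫⁻ v, F (y, v) ∂chainKer (C.predKer x₀) (List.finRange s) (y, 0) := by
  have := fun t => isMarkovKernel_predKer (hq t) x₀
  have : SigmaFinite C.refPrior := by rw [refPrior_eq]; infer_instance
  have hm := C.measurable_lintegral_sample A x₀ hF
  rw [jointLaw_refPrior hP hR hA hRA, lintegral_smul_measure, smul_eq_mul,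
    Measure.lintegral_bind (C.measurable_sampleLaw A x₀).aemeasurable hF.aemeasurable]
  simp only [C.lintegral_sampleLaw A x₀ _ hF]
  -- The prior is improper but σ-finite, so Tonelli still permits integrating over the parameters
  -- first, for fixed `y`.
  rw [lintegral_lintegral_swap hm.aemeasurable, ← lintegral_const_mul _ (by
    exact hm.lintegral_prod_left')]
  refine lintegral_congr_ae ?_
  filter_upwards [ae_nondegenerate hR hH hq] with y hy
  rw [mul_assoc, lintegral_refPrior hR hq hc hA hRA hy (F := fun v => F (y, v))
    (hF.comp measurable_prodMk_left)]

end JointLaw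

theorem measurable_levelLaw_map_update (x₀ : 𝒳) {t : Fin s} (hq : C.q t < C.n t) (y : C.Data) :
    Measurable fun v : Fin s → ℝ =>
      (C.levelLaw t x₀ (fun u => y u.1) (y t) (fun u => v u.1)).map (Function.update v t) := by
  have := isMarkovKernel_predKer hq x₀
  refine Measure.measurable_of_measurable_coe _ fun S hS => ?_
  have h := Measurable.lintegral_kernel_prod_right'
    (κ := (C.predKer x₀ t).comap (fun v => (y, v)) measurable_prodMk_left)
    (f := fun p : (Fin s → ℝ) × ℝ => S.indicator 1 (Function.update p.1 t p.2))
    ((measurable_one.indicator hS).comp measurable_update')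
  refine (congrArg Measurable (funext fun v => ?_)).mpr h
  rw [← lintegral_indicator_one hS, lintegral_map (measurable_one.indicator hS)
    (measurable_update v)]
  rfl

/-- The recursive definition of `chainLaw` unrolls from the left as `chainKer` does; the initial
measure is kept arbitrary because it changes at each link. -/
theorem lintegral_foldl_levelLaw (hq : ∀ t, C.q t < C.n t) (x₀ : 𝒳) (y : C.Data)
    (l : List (Fin s)) (μ : Measure (Fin s → ℝ)) {F : (Fin s → ℝ) → ℝ≥0∞} (hF : Measurable F) :
    ∫⁻ v, F v ∂l.foldl (fun μ t => μ.bind fun v =>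
        (C.levelLaw t x₀ (fun u => y u.1) (y t) (fun u => v u.1)).map (Function.update v t)) μ =
      ∫⁻ v, ∫⁻ w, F w ∂chainKer (C.predKer x₀) l (y, v) ∂μ := by
  have := fun t => isMarkovKernel_predKer (hq t) x₀
  induction l generalizing μ with
  | nil => simp only [List.foldl_nil, lintegral_chainKer_nil _ hF]
  | cons t l ih =>
    have hm : Measurable fun v => ∫⁻ w, F w ∂chainKer (C.predKer x₀) l (y, v) :=
      hF.lintegral_kernel.comp measurable_prodMk_left
    rw [List.foldl_cons, ih, Measure.lintegral_bind
      (measurable_levelLaw_map_update x₀ (hq t) y).aemeasurable hm.aemeasurable]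
    refine lintegral_congr fun v => ?_
    rw [lintegral_map hm (measurable_update v), lintegral_chainKer_cons _ _ _ hF]
    rfl

theorem chainKer_predKer_eq_chainLaw (hq : ∀ t, C.q t < C.n t) (x₀ : 𝒳) (y : C.Data) :
    chainKer (C.predKer x₀) (List.finRange s) (y, 0) = C.chainLaw x₀ y := by
  have := fun t => isMarkovKernel_predKer (hq t) x₀
  refine Measure.ext_of_lintegral _ fun F hF => ?_
  have hm : Measurable fun v => ∫⁻ w, F w ∂chainKer (C.predKer x₀) (List.finRange s) (y, v) :=
    hF.lintegral_kernel.comp measurable_prodMk_left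
  rw [chainLaw, Fin.foldl_eq_finRange_foldl, lintegral_foldl_levelLaw hq x₀ y _ _ hF,
    lintegral_dirac' _ hm]

/-- The predictive Student distribution of level `t`, as a kernel on all the data and the outputs
at `x₀` of the lower levels. -/
noncomputable def sequentialKer (C : Cokriging 𝒳 s) (x₀ : 𝒳) (t : Fin s) :
    Kernel (C.Data × (Set.Iio t → ℝ)) ℝ :=
  (C.levelKer t x₀).comap
    (fun p => (((fun u : Prev t => p.1 u.1), p.1 t), fun u => p.2 ⟨u.1, Prev.lt u⟩))
    (by fun_prop)

theorem isMarkovKernel_sequentialKer {t : Fin s} (hq : C.q t < C.n t) (x₀ : 𝒳) :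
    IsMarkovKernel (C.sequentialKer x₀ t) := by
  have := isMarkovKernel_levelKer hq x₀
  unfold sequentialKer
  infer_instance

/-- In a chain, the outputs of the levels up to `t` are those of the levels below `t`, followed by
a draw from the predictive distribution of level `t`. -/
theorem lintegral_chainKer_predKer (hq : ∀ t, C.q t < C.n t) (x₀ : 𝒳) (y : C.Data) (t : Fin s)
    {F : (Set.Iio t → ℝ) × ℝ → ℝ≥0∞} (hF : Measurable F) :
    ∫⁻ v, F (fun u => v u, v t) ∂chainKer (C.predKer x₀) (List.finRange s) (y, 0) =
      ∫⁻ v, ∫⁻ x, F (fun u => v u, x) ∂C.sequentialKer x₀ t (y, fun u => v u)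
        ∂chainKer (C.predKer x₀) (List.finRange s) (y, 0) := by
  have := fun t => isMarkovKernel_predKer (hq t) x₀
  have := isMarkovKernel_sequentialKer (hq t) x₀
  -- Splits the chain at `t`. The left integrand ignores the levels in `l₂`, and the right one
  -- ignores those in `t :: l₂`; these Markov links integrate to one, so only the `l₁` chain and one
  -- draw at `t` remain.
  obtain ⟨l₁, l₂, hl⟩ := List.append_of_mem (List.mem_finRange t)
  have hp := List.pairwise_lt_finRange s
  rw [hl, List.pairwise_append, List.pairwise_cons] at hp
  have h2 : ∀ u ∈ l₂, t < u := hp.2.1.1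
  have hF1 : Measurable fun v : Fin s → ℝ => F (fun u : Set.Iio t => v u, v t) :=
    hF.comp (by fun_prop)
  have hF2 : Measurable fun v : Fin s → ℝ =>
      ∫⁻ x, F (fun u : Set.Iio t => v u, x) ∂C.sequentialKer x₀ t (y, fun u => v u) := by
    have h := Measurable.lintegral_kernel_prod_right'
      (κ := (C.sequentialKer x₀ t).comap (fun v : Fin s → ℝ => (y, fun u => v u)) (by fun_prop))
      (f := fun p : (Fin s → ℝ) × ℝ => F (fun u : Set.Iio t => p.1 u, p.2))
      (hF.comp (by fun_prop))
    exact h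
  rw [hl, lintegral_chainKer_append _ _ _ hF1, lintegral_chainKer_append _ _ _ hF2]
  refine lintegral_congr fun v => ?_
  have hupd : ∀ x, (fun u : Set.Iio t => Function.update v t x u) = fun u : Set.Iio t => v u :=
    fun x => funext fun u => Function.update_of_ne u.2.ne _ _
  rw [lintegral_chainKer_cons _ _ _ hF1,
    lintegral_chainKer_of_forall_update (C.predKer x₀) (t :: l₂) hF2]
  · refine lintegral_congr fun x => ?_
    rw [lintegral_chainKer_of_forall_update (C.predKer x₀) l₂ hF1, hupd, Function.update_self]
    intro r hr w z
    have hw : (fun u : Set.Iio t => Function.update w r z u) = fun u : Set.Iio t => w u :=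
      funext fun u => Function.update_of_ne (u.2.trans (h2 r hr)).ne _ _
    rw [hw, Function.update_of_ne (h2 r hr).ne]
  · intro r hr w z
    have hle : t ≤ r := by
      rcases List.mem_cons.mp hr with rfl | hr
      · exact le_rfl
      · exact (h2 r hr).le
    have hw : (fun u : Set.Iio t => Function.update w r z u) = fun u : Set.Iio t => w u :=
      funext fun u => Function.update_of_ne (lt_of_lt_of_le u.2 hle).ne _ _
    rw [hw]

end Cokriging

/-! ### The joint law as a composition product, and its conditional laws -/

namespace Cokriging

variable {𝒳 : Type*} {s : ℕ} [DecidableEq 𝒳] {C : Cokriging 𝒳 s}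

/-- The chain of the predictive Student distributions, as a kernel on the data. -/
noncomputable def predictive (C : Cokriging 𝒳 s) (x₀ : 𝒳) : Kernel C.Data (Fin s → ℝ) :=
  (chainKer (C.predKer x₀) (List.finRange s)).comap (fun y => (y, 0)) (by fun_prop)

theorem isMarkovKernel_predictive (hq : ∀ t, C.q t < C.n t) (x₀ : 𝒳) :
    IsMarkovKernel (C.predictive x₀) := by
  have := fun t => isMarkovKernel_predKer (hq t) x₀
  have := isMarkovKernel_chainKer (C.predKer x₀) (List.finRange s)
  unfold predictive
  infer_instance

/-- Let `J` be a density for the data, followed by the chain of the predictive distributions. Then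
the conditional law of the output of level `t` given the data and the outputs of the lower levels
is the predictive distribution of level `t`. -/
theorem isCondKernel_sequentialKer (hq : ∀ t, C.q t < C.n t) (x₀ : 𝒳) (M : Measure C.Data)
    [SigmaFinite M] (t : Fin s) :
    SigmaFinite ((M ⊗ₘ C.predictive x₀).map
        fun z => ((z.1, fun u : Set.Iio t => z.2 u), z.2 t)).fst ∧
      ((M ⊗ₘ C.predictive x₀).map
        fun z => ((z.1, fun u : Set.Iio t => z.2 u), z.2 t)).IsCondKernel
          (C.sequentialKer x₀ t) := by
  have := isMarkovKernel_predictive hq x₀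
  have := isMarkovKernel_sequentialKer (hq t) x₀
  have hm : Measurable fun z : C.Data × (Fin s → ℝ) =>
      ((z.1, fun u : Set.Iio t => z.2 u), z.2 t) := by fun_prop
  have hm' : Measurable fun z : C.Data × (Fin s → ℝ) =>
      (z.1, fun u : Set.Iio t => z.2 u) := by fun_prop
  have hfst : ((M ⊗ₘ C.predictive x₀).map
      fun z => ((z.1, fun u : Set.Iio t => z.2 u), z.2 t)).fst =
      (M ⊗ₘ C.predictive x₀).map fun z => (z.1, fun u : Set.Iio t => z.2 u) := by
    rw [Measure.fst, Measure.map_map measurable_fst hm]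
    rfl
  have hσ : SigmaFinite ((M ⊗ₘ C.predictive x₀).map
      fun z => (z.1, fun u : Set.Iio t => z.2 u)) := by
    -- σ-finiteness lifts from an image: projecting further to the data gives back `M`, because the
    -- predictive kernel is Markov.
    refine SigmaFinite.of_map _ measurable_fst.aemeasurable ?_
    rw [Measure.map_map measurable_fst hm']
    change SigmaFinite (M ⊗ₘ C.predictive x₀).fst
    rw [Measure.fst_compProd]
    infer_instance
  rw [hfst]
  refine ⟨hσ, ⟨?_⟩⟩
  rw [hfst]
  refine Measure.ext_of_lintegral _ fun F hF => ?_
  have hG := Measurable.lintegral_kernel_prod_right' (κ := C.sequentialKer x₀ t) hF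
  rw [Measure.lintegral_compProd hF, lintegral_map hG hm', lintegral_map hF hm]
  refine (Measure.lintegral_compProd (hG.comp hm')).trans <| Eq.trans ?_
    (Measure.lintegral_compProd (hF.comp hm)).symm
  refine lintegral_congr fun y => ?_
  exact (lintegral_chainKer_predKer hq x₀ y t (F := fun p => F ((y, p.1), p.2))
    (hF.comp (by fun_prop))).symm

/-- The joint law is a density for the data, followed by the chain of the predictive
distributions. -/
theorem exists_jointLaw_eq_compProd {Ω : Type*} [MeasurableSpace Ω] {Y : Fin s → 𝒳 → Ω → ℝ}
    {P : C.Param → Measure Ω}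
    (hP : ∀ θ : C.Param, (∀ t, 0 < (θ t).2) → C.IsCokrigingModel Y θ (P θ))
    (hR : ∀ t, (C.R t).PosDef) (hH : ∀ t, (C.H t).rank = C.p t) (hq : ∀ t, C.q t < C.n t)
    {c : ℝ≥0∞} (hc₀ : c ≠ 0) (hc : c ≠ ∞) (x₀ : 𝒳) :
    ∃ M : Measure C.Data, SigmaFinite M ∧ M ≪ volume ∧ volume ≪ M ∧
      C.jointLaw Y P (c • C.refPrior) x₀ = M ⊗ₘ C.predictive x₀ := by
  have := isMarkovKernel_predictive hq x₀
  choose A hA hRA using fun t => (hR t).inv.exists_isUnit_det_eq_transpose_mul_self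
  have hv : ∀ t, 0 ≤ C.condVar t x₀ := by
    intro t
    -- Positive semidefiniteness of `r_t` comes only through the model, so any parameter with
    -- positive variances is used to obtain a nonnegative kriging variance.
    have hM := hP (fun _ => (0, 1)) fun _ => one_pos
    have := hM.indep.isProbabilityMeasure
    exact (hM.lintegral_residuals x₀ t one_pos (hR t) (hA t) (hRA t)).1
  have hd : Measurable fun y : C.Data => c * ∏ t, C.margDens A t y :=
    (Finset.measurable_fun_prod _ fun t _ => C.measurable_margDens A t).const_mul c
  have hpos : ∀ᵐ y : C.Data, c * ∏ t, C.margDens A t y ≠ 0 := by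
    filter_upwards [ae_nondegenerate hR hH hq] with y hy
    exact mul_ne_zero hc₀ (Finset.prod_ne_zero_iff.mpr fun t _ =>
      (lintegral_dataDens (hR t) (hq t) (hv t) (hA t) (hRA t) (hy t).1 (hy t).2).1)
  have hfin : ∀ᵐ y : C.Data, c * ∏ t, C.margDens A t y ≠ ∞ := by
    filter_upwards [ae_nondegenerate hR hH hq] with y hy
    exact ENNReal.mul_ne_top hc (ENNReal.prod_ne_top fun t _ =>
      (lintegral_dataDens (hR t) (hq t) (hv t) (hA t) (hRA t) (hy t).1 (hy t).2).2.1)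
  have hσ := SigmaFinite.withDensity_of_ne_top hfin
  refine ⟨(volume : Measure C.Data).withDensity fun y => c * ∏ t, C.margDens A t y, hσ,
    withDensity_absolutelyContinuous _ _,
    withDensity_absolutelyContinuous' hd.aemeasurable hpos, ?_⟩
  refine Measure.ext_of_lintegral _ fun F hF => ?_
  rw [lintegral_jointLaw hP hR hH hq hA hRA c hv hF, Measure.lintegral_compProd hF,
    lintegral_withDensity_eq_lintegral_mul _ hd
      (Measurable.lintegral_kernel_prod_right' (κ := C.predictive x₀) hF)]
  rfl

end Cokriging

theorem mainTheorem2 {𝒳 : Type*} [DecidableEq 𝒳] {s : ℕ} (C : Cokriging 𝒳 s)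
    {Ω : Type*} [MeasurableSpace Ω] (Y : Fin s → 𝒳 → Ω → ℝ) (P : C.Param → Measure Ω)
    (hP : ∀ θ : C.Param, (∀ t, 0 < (θ t).2) → C.IsCokrigingModel Y θ (P θ))
    (hR : ∀ t, (C.R t).PosDef)
    (hH : ∀ t, (C.H t).rank = C.p t)
    (hq : ∀ t, C.q t < C.n t)
    (π : Measure C.Param) (c : ℝ≥0∞) (hc₀ : c ≠ 0) (hc : c ≠ ∞) (hπ : π = c • C.refPrior)
    (x₀ : 𝒳) :
    -- the marginal law of the data is σ-finite and equivalent to Lebesgue measure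
    (SigmaFinite (C.jointLaw Y P π x₀).fst ∧
      (C.jointLaw Y P π x₀).fst ≪ (volume : Measure C.Data) ∧
      (volume : Measure C.Data) ≪ (C.jointLaw Y P π x₀).fst) ∧
    -- for almost all data the formulas are non-degenerate
    (∀ᵐ y : C.Data, ∀ t, IsUnit (C.gram t fun u => y u.1).det ∧
      0 < C.sigmaHatSq t (fun u => y u.1) (y t)) ∧
    -- the joint predictive law of `y(x₀)` given `y` is the chain of the level-by-level conditionals
    (∃ K : Kernel C.Data (Fin s → ℝ), IsMarkovKernel K ∧ (∀ y, K y = C.chainLaw x₀ y) ∧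
      (C.jointLaw Y P π x₀).IsCondKernel K) ∧
    -- the conditional law of `y_t(x₀)` given `y` and `y_1(x₀), …, y_{t-1}(x₀)` depends only on
    -- `y_{t-1}`, `y_t` and `y_{t-1}(x₀)`, and it is the stated Student distribution
    (∀ t : Fin s, ∃ κ : Kernel (C.Data × (Set.Iio t → ℝ)) ℝ, IsMarkovKernel κ ∧
      (∀ (y : C.Data) (v : Fin s → ℝ), κ (y, fun u => v u) =
        C.levelLaw t x₀ (fun u => y u.1) (y t) (fun u => v u.1)) ∧
      SigmaFinite ((C.jointLaw Y P π x₀).map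
        fun z => ((z.1, fun u : Set.Iio t => z.2 u), z.2 t)).fst ∧
      ((C.jointLaw Y P π x₀).map
        fun z => ((z.1, fun u : Set.Iio t => z.2 u), z.2 t)).IsCondKernel κ) ∧
    -- `b̂_t` is the generalized least squares estimate, the unique minimizer of the generalized
    -- sum of squares
    (∀ (t : Fin s) (yp : C.PrevData t) (y : C.X t → ℝ), IsUnit (C.gram t yp).det →
      ∀ b, b ≠ C.bhat t yp y → C.gss t yp y (C.bhat t yp y) < C.gss t yp y b) := by

  subst hπ
  obtain ⟨M, hσ, hM, hM', hJ⟩ := C.exists_jointLaw_eq_compProd hP hR hH hq hc₀ hc x₀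
  have hpred := C.isMarkovKernel_predictive hq x₀
  have hfst : (C.jointLaw Y P (c • C.refPrior) x₀).fst = M := by
    rw [hJ, Measure.fst_compProd]
  refine ⟨?_, C.ae_nondegenerate hR hH hq, ?_, ?_, ?_⟩
  · rw [hfst]
    exact ⟨hσ, hM, hM'⟩
  · exact ⟨C.predictive x₀, hpred, C.chainKer_predKer_eq_chainLaw hq x₀,
      ⟨by rw [hfst, hJ]⟩⟩
  · intro t
    obtain ⟨h1, h2⟩ := C.isCondKernel_sequentialKer hq x₀ M t
    rw [hJ]
    exact ⟨C.sequentialKer x₀ t, C.isMarkovKernel_sequentialKer (hq t) x₀, fun _ _ => rfl, h1, h2⟩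
  · exact fun t yp y hg b hb => C.gss_bhat_lt (hR t) hg y hb
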